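/- Let $n\ge 1$ and let $\Omega'_n$ be a closed disk with $n$ labelled marked points in its interior and one marked point on its boundary. An arc is an isotopy class (fixing the marked points) of simple arcs with endpoints at marked points, where arcs that are null-homotopic or parallel to the boundary curve are not counted. A triangulation of $\Omega'_n$ is a maximal collection of distinct arcs that are pairwise disjoint except possibly at their endpoints; loops, multiple edges and self-folded triangles are allowed. Equivalently, up to homeomorphism, it is a gluing of finitely many oriented triangles along sides, compatible with the orientations, that yields a disk with exactly one unglued side, whose vertices are precisely the boundary marked point and the $n$ labelled interior points. The modular simultaneous flip graph $\mathcal{MF}^s(\Omega'_n)$ has as vertices the triangulations of $\Omega'_n$ up to homeomorphisms of the disk that fix every marked point. Two distinct vertices are joined by an edge if they are represented by triangulations that differ by finitely many flips supported on quadrilaterals with pairwise disjoint interiors; here a flip replaces an arc that lies on two different triangles by the other diagonal of the quadrilateral they form. Then $\mathcal{MF}^s(\Omega'_n)$ is connected, its diameter is finite, and $$\operatorname{diam}\bigl(\mathcal{MF}^s(\Omega'_n)\bigr) < 1000\,\bigl(\log(n+1)\bigr)^2 .$$ The same holds if only orientation-preserving homeomorphisms are used to identify triangulations. -/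

import Mathlib

/-! Triangulations of a disk with `n` labelled interior marked points and one marked point on the
boundary, up to homeomorphism, as labelled combinatorial maps (gluings of oriented triangles), and
the graph of simultaneous flips on them. -/

namespace FlipDisk

open Equiv

/-- The number of orbits (cycles, including fixed points) of a permutation. -/
noncomputable def orbitCount {D : Type} (f : Perm D) : ℕ :=
  Nat.card (Quotient (Perm.SameCycle.setoid f))

/-- A triangulation of the disk with interior marked points labelled by `Fin n` and one boundary
marked point (labelled `none`), with set `D` of oriented edges ("darts"). A dart lies on the
boundary of the face on its left. Loops, multiple edges and self-folded triangles are allowed.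
The disk is closed up to a sphere by one further face, whose only side is the dart `root`, so that
`root` and `opp root` are the two orientations of the boundary curve of the disk. -/
structure Triangulation (n : ℕ) (D : Type) where
  /-- the next dart along the boundary of the face on the left -/
  next : Perm D
  /-- the same edge with the opposite orientation -/
  opp : Perm D
  /-- the boundary curve, with the complement of the disk on its left -/
  root : D
  /-- the label of the initial point of a dart -/
  vert : D → Option (Fin n)
  opp_opp : ∀ d, opp (opp d) = d
  opp_ne : ∀ d, opp d ≠ d
  /-- the outer face has exactly one side -/
  next_root : next root = root
  /-- every other face is a triangle -/
  next_ne : ∀ d, d ≠ root → next d ≠ d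
  next_next_next : ∀ d, next (next (next d)) = d
  /-- the surface is connected -/
  connected : ∀ d d', ∃ g ∈ Subgroup.closure ({next, opp} : Set (Perm D)), g d = d'
  /-- Vertices are the orbits of `next * opp`, which turns a dart about its initial point; distinct
  vertices have distinct labels -/
  vert_eq_iff : ∀ d d', vert d = vert d' ↔ (next * opp).SameCycle d d'
  /-- every marked point is a vertex -/
  vert_surjective : Function.Surjective vert
  /-- the boundary curve is based at the boundary marked point -/
  vert_root : vert root = none
  /-- Euler's formula (vertices + faces = edges + 2): the closed-up surface is a sphere -/
  euler : orbitCount (next * opp) + orbitCount next = orbitCount opp + 2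

variable {n : ℕ} {D E F : Type}

/-- An orientation-preserving homeomorphism that fixes every marked point carries `T` to `T'`. -/
def OrientedIso (T : Triangulation n D) (T' : Triangulation n E) : Prop :=
  ∃ e : D ≃ E, ∀ d, T'.next (e d) = e (T.next d) ∧ T'.opp (e d) = e (T.opp d) ∧
    T'.vert (e d) = T.vert d

/-- An orientation-reversing homeomorphism that fixes every marked point carries `T` to `T'`. Here
`e d` is the image of the dart `d` run backwards, which has the image of the left face of `d` on
its left. -/
def ReversingIso (T : Triangulation n D) (T' : Triangulation n E) : Prop :=
  ∃ e : D ≃ E, ∀ d, T'.next (e d) = e (T.next.symm d) ∧ T'.opp (e d) = e (T.opp d) ∧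
    T'.vert (e d) = T.vert (T.opp d)

theorem OrientedIso.refl (T : Triangulation n D) : OrientedIso T T :=
  ⟨Equiv.refl D, fun _ => ⟨rfl, rfl, rfl⟩⟩

theorem OrientedIso.symm {T : Triangulation n D} {T' : Triangulation n E}
    (h : OrientedIso T T') : OrientedIso T' T := by
  obtain ⟨e, h⟩ := h
  refine ⟨e.symm, fun d => ?_⟩
  obtain ⟨d, rfl⟩ := e.surjective d
  obtain ⟨h1, h2, h3⟩ := h d
  simp [h1, h2, h3]

theorem OrientedIso.trans {T : Triangulation n D} {T' : Triangulation n E}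
    {T'' : Triangulation n F} (h : OrientedIso T T') (h' : OrientedIso T' T'') :
    OrientedIso T T'' := by
  obtain ⟨e, h⟩ := h
  obtain ⟨e', h'⟩ := h'
  exact ⟨e.trans e', fun d => by simp [h, h']⟩

theorem ReversingIso.symm {T : Triangulation n D} {T' : Triangulation n E}
    (h : ReversingIso T T') : ReversingIso T' T := by
  obtain ⟨e, h⟩ := h
  refine ⟨e.symm, fun d => ?_⟩
  obtain ⟨d, rfl⟩ := e.surjective d
  have h1 := (h (T.next d)).1
  obtain ⟨-, h2, -⟩ := h d
  have h3 := (h (T.opp d)).2.2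
  rw [Equiv.symm_apply_apply] at h1
  rw [T.opp_opp] at h3
  have h4 : T'.next.symm (e d) = e (T.next d) := by rw [← h1, Equiv.symm_apply_apply]
  exact ⟨by simp [h4], by simp [h2], by simp [h2, h3]⟩

theorem ReversingIso.trans {T : Triangulation n D} {T' : Triangulation n E}
    {T'' : Triangulation n F} (h : ReversingIso T T') (h' : ReversingIso T' T'') :
    OrientedIso T T'' := by
  obtain ⟨e, h⟩ := h
  obtain ⟨e', h'⟩ := h'
  refine ⟨e.trans e', fun d => ?_⟩
  have h1 := (h (T.next d)).1
  rw [Equiv.symm_apply_apply] at h1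
  refine ⟨?_, by simp [h, h'], by simp [h, h', T.opp_opp]⟩
  simp [h', ← h1]

theorem OrientedIso.trans_reversing {T : Triangulation n D} {T' : Triangulation n E}
    {T'' : Triangulation n F} (h : OrientedIso T T') (h' : ReversingIso T' T'') :
    ReversingIso T T'' := by
  obtain ⟨e, h⟩ := h
  obtain ⟨e', h'⟩ := h'
  refine ⟨e.trans e', fun d => ?_⟩
  have h1 := (h (T.next.symm d)).1
  rw [Equiv.apply_symm_apply] at h1
  refine ⟨?_, by simp [h, h'], by simp [h, h']⟩
  simp [h', ← h1]

theorem ReversingIso.trans_oriented {T : Triangulation n D} {T' : Triangulation n E}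
    {T'' : Triangulation n F} (h : ReversingIso T T') (h' : OrientedIso T' T'') :
    ReversingIso T T'' :=
  (h'.symm.trans_reversing h.symm).symm

/-- Triangulations of the disk with `n` labelled interior marked points, with any finite number of
edges. -/
def Tri (n : ℕ) : Type := Σ m : ℕ, Triangulation n (Fin m)

/-- Being related by an orientation-preserving homeomorphism that fixes every marked point. -/
def orientedSetoid (n : ℕ) : Setoid (Tri n) where
  r T T' := OrientedIso T.2 T'.2
  iseqv := ⟨fun T => OrientedIso.refl T.2, fun h => h.symm, fun h h' => h.trans h'⟩

/-- Being related by a homeomorphism, of either kind, that fixes every marked point. -/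
def homeoSetoid (n : ℕ) : Setoid (Tri n) where
  r T T' := OrientedIso T.2 T'.2 ∨ ReversingIso T.2 T'.2
  iseqv := by
    refine ⟨fun T => Or.inl (OrientedIso.refl T.2), ?_, ?_⟩
    · rintro _ _ (h | h)
      · exact Or.inl h.symm
      · exact Or.inr h.symm
    · rintro _ _ _ (h | h) (h' | h')
      · exact Or.inl (h.trans h')
      · exact Or.inr (h.trans_reversing h')
      · exact Or.inr (h.trans_oriented h')
      · exact Or.inl (h.trans h')

/-- `T'` arises from `T` by simultaneously flipping the arcs whose darts form the set `S`.
The flipped arcs are interior arcs, and no triangle has two sides in `S`: so each of them is the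
diagonal of a quadrilateral made of two different triangles, and these quadrilaterals have disjoint
interiors. If `d ∈ S` lies in the triangle `(d, a, b)` and `opp d` in `(opp d, c, f)`, then these
two triangles become `(a, d, f)` and `(c, opp d, b)`, where `d` now runs from the initial point of
`b` to that of `f`. -/
def FlipAlong (S : Set D) (T T' : Triangulation n D) : Prop :=
  T.root ∉ S ∧
  (∀ d ∈ S, T.opp d ∈ S ∧ T.next d ∉ S ∧ T.next (T.next d) ∉ S) ∧
  T'.opp = T.opp ∧
  (∀ d ∈ S, T'.next (T.next d) = d ∧ T'.next d = T.next (T.next (T.opp d)) ∧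
    T'.next (T.next (T.next d)) = T.next (T.opp d)) ∧
  (∀ d, d ∉ S → T.next d ∉ S → T.next (T.next d) ∉ S → T'.next d = T.next d) ∧
  (∀ d ∈ S, T'.vert d = T.vert (T.next (T.next d))) ∧
  (∀ d, d ∉ S → T'.vert d = T.vert d)

/-- The simultaneous flip graph on the classes of triangulations for an equivalence relation `s`:
two different classes are adjacent when they have representatives that differ by one simultaneous
flip. -/
def flipGraph (s : Setoid (Tri n)) : SimpleGraph (Quotient s) :=
  SimpleGraph.fromRel fun X Y => ∃ (m : ℕ) (S : Set (Fin m)) (T T' : Triangulation n (Fin m)),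
    FlipAlong S T T' ∧ X = Quotient.mk s ⟨m, T⟩ ∧ Y = Quotient.mk s ⟨m, T'⟩

/-- The modular simultaneous flip graph: triangulations up to homeomorphisms fixing every marked
point. -/
def modularFlipGraph (n : ℕ) : SimpleGraph (Quotient (homeoSetoid n)) :=
  flipGraph (homeoSetoid n)

/-- The modular simultaneous flip graph in which only orientation-preserving homeomorphisms are
used to identify triangulations. -/
def orientedModularFlipGraph (n : ℕ) : SimpleGraph (Quotient (orientedSetoid n)) :=
  flipGraph (orientedSetoid n)

end FlipDisk

namespace FlipDisk

open Equiv

/-! Cut the disk along arcs so that its triangles form a polygon. The polygon has one side at the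
boundary curve and, by Euler's formula, `2 * n` further sides that are glued in pairs. Its
triangulation is a binary tree, and rotations at disjoint places of the tree are simultaneous flips
that leave the gluing of the sides alone.

Two binary trees with `N` leaves are `O(log N)` simultaneous rotations apart. A bounded number of
rotations creates enough pairs of sibling leaves that collapsing them removes a constant proportion
of the leaves (`BinTree.contractible`); iterating this leads to a comb (`BinTree.simRots_comb`,
`BinTree.exists_simRots`). For a triangulation, a comb is a fan at the boundary marked point, so
every marked point becomes adjacent to it. The disk can then be cut along a star: one arc from the
boundary marked point to each other marked point (`exists_isStar`). Shape and cyclic order of the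
star determine the triangulation (`IsStar.orientedIso`).

It remains to bring the order of the star into a normal form. If the polygon has a suitable shape,
then cutting the same triangulation along diagonals in place of some of the sides moves any chosen
set of labels to the end of the order, without any flip (`IsStar.pass`). Radix sort needs `O(log n)`
such moves, each prepared by `O(log n)` flips that produce the suitable shape. This gives `O((log
n)^2)` altogether. Only oriented homeomorphisms are used, so both graphs are treated at once. -/

/-! ### Simultaneous rotations of binary trees -/

/-- Binary trees with labelled leaves: triangulations of a polygon with one distinguished side. -/
inductive BinTree (α : Type) : Type
  | leaf : α → BinTree α
  | node : BinTree α → BinTree α → BinTree α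

namespace BinTree

variable {α β : Type}

/-- The list of leaves, from left to right. -/
def leaves : BinTree α → List α
  | leaf a => [a]
  | node l r => l.leaves ++ r.leaves

/-- The number of leaves. -/
def count : BinTree α → ℕ
  | leaf _ => 1
  | node l r => l.count + r.count

/-- Replace every leaf by a tree. -/
def bind (f : α → BinTree β) : BinTree α → BinTree β
  | leaf a => f a
  | node l r => node (l.bind f) (r.bind f)

theorem count_pos (t : BinTree α) : 1 ≤ t.count := by
  induction t with
  | leaf => simp [count]
  | node l r h1 h2 => simp only [count]; omega

theorem length_leaves (t : BinTree α) : t.leaves.length = t.count := by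
  induction t with
  | leaf => rfl
  | node l r h1 h2 => simp [leaves, count, h1, h2]

theorem leaves_bind (f : α → BinTree β) (t : BinTree α) :
    (t.bind f).leaves = t.leaves.flatMap fun a => (f a).leaves := by
  induction t with
  | leaf => simp [bind, leaves]
  | node l r h1 h2 => simp [bind, leaves, h1, h2]

/-- One simultaneous rotation: rotations at disjoint pairs of adjacent nodes. -/
inductive SimRot : BinTree α → BinTree α → Prop
  | leaf (a : α) : SimRot (leaf a) (leaf a)
  | node {a a' b b' : BinTree α} : SimRot a a' → SimRot b b' → SimRot (node a b) (node a' b')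
  | left {a a' b b' c c' : BinTree α} : SimRot a a' → SimRot b b' → SimRot c c' →
      SimRot (node a (node b c)) (node (node a' b') c')
  | right {a a' b b' c c' : BinTree α} : SimRot a a' → SimRot b b' → SimRot c c' →
      SimRot (node (node a b) c) (node a' (node b' c'))

theorem SimRot.refl (t : BinTree α) : SimRot t t := by
  induction t with
  | leaf a => exact .leaf a
  | node l r h1 h2 => exact .node h1 h2

theorem SimRot.symm {t t' : BinTree α} (h : SimRot t t') : SimRot t' t := by
  induction h with
  | leaf a => exact .leaf a
  | node _ _ h1 h2 => exact .node h1 h2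
  | left _ _ _ h1 h2 h3 => exact .right h1 h2 h3
  | right _ _ _ h1 h2 h3 => exact .left h1 h2 h3

theorem SimRot.leaves_eq {t t' : BinTree α} (h : SimRot t t') : t'.leaves = t.leaves := by
  induction h with
  | leaf a => rfl
  | node _ _ h1 h2 => simp [leaves, h1, h2]
  | left _ _ _ h1 h2 h3 => simp [leaves, h1, h2, h3]
  | right _ _ _ h1 h2 h3 => simp [leaves, h1, h2, h3]

theorem SimRot.bind {t t' : BinTree α} (h : SimRot t t') (f : α → BinTree β) :
    SimRot (t.bind f) (t'.bind f) := by
  induction h with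
  | leaf a => exact .refl _
  | node _ _ h1 h2 => exact .node h1 h2
  | left _ _ _ h1 h2 h3 => exact .left h1 h2 h3
  | right _ _ _ h1 h2 h3 => exact .right h1 h2 h3

/-- A sequence of `k` simultaneous rotations. -/
def SimRots : ℕ → BinTree α → BinTree α → Prop
  | 0, t, t' => t = t'
  | k + 1, t, t' => ∃ u, SimRot t u ∧ SimRots k u t'

theorem SimRots.refl (k : ℕ) (t : BinTree α) : SimRots k t t := by
  induction k with
  | zero => rfl
  | succ k ih => exact ⟨t, .refl t, ih⟩

theorem SimRots.trans {j k : ℕ} {t u w : BinTree α} (h : SimRots j t u) (h' : SimRots k u w) :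
    SimRots (j + k) t w := by
  induction j generalizing t with
  | zero => cases h; simpa using h'
  | succ j ih =>
    obtain ⟨x, hx, hy⟩ := h
    rw [Nat.add_right_comm]
    exact ⟨x, hx, ih hy⟩

theorem SimRot.simRots {t u : BinTree α} (h : SimRot t u) : SimRots 1 t u := ⟨u, h, rfl⟩

theorem SimRots.symm {k : ℕ} {t u : BinTree α} (h : SimRots k t u) : SimRots k u t := by
  induction k generalizing t with
  | zero => exact Eq.symm h
  | succ j ih =>
    obtain ⟨x, hx, hy⟩ := h
    exact (ih hy).trans hx.symm.simRots

theorem SimRots.leaves_eq {k : ℕ} {t u : BinTree α} (h : SimRots k t u) :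
    u.leaves = t.leaves := by
  induction k generalizing t with
  | zero => rw [show t = u from h]
  | succ j ih =>
    obtain ⟨x, hx, hy⟩ := h
    rw [ih hy, hx.leaves_eq]

theorem SimRots.bind {k : ℕ} {t u : BinTree α} (h : SimRots k t u) (f : α → BinTree β) :
    SimRots k (t.bind f) (u.bind f) := by
  induction k generalizing t with
  | zero => rw [show t = u from h]; rfl
  | succ j ih =>
    obtain ⟨x, hx, hy⟩ := h
    exact ⟨_, hx.bind f, ih hy⟩

theorem SimRots.node {k : ℕ} {a a' b b' : BinTree α} (h : SimRots k a a') (h' : SimRots k b b') :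
    SimRots k (node a b) (node a' b') := by
  induction k generalizing a b with
  | zero => rw [show a = a' from h, show b = b' from h']; rfl
  | succ j ih =>
    obtain ⟨x, hx, hy⟩ := h
    obtain ⟨x', hx', hy'⟩ := h'
    exact ⟨_, .node hx hx', ih hy hy'⟩

/-- The tree that arises from `t` by attaching the leaves in a list one by one from the right. -/
def spine (t : BinTree α) (L : List α) : BinTree α := L.foldl (fun u a => node u (leaf a)) t

/-- The tree with a given list of leaves all of whose nodes lie on its left branch. -/
def comb : List α → Option (BinTree α)
  | [] => none
  | a :: L => some (spine (leaf a) L)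

theorem bind_spine (f : α → BinTree β) (t : BinTree α) (L : List α) :
    (spine t L).bind f = L.foldl (fun u a => BinTree.node u (f a)) (t.bind f) := by
  induction L generalizing t with
  | nil => rfl
  | cons a L ih => simpa [spine, BinTree.bind] using ih (BinTree.node t (leaf a))

/-- A leaf or a pair of sibling leaves. -/
def small : α ⊕ α × α → BinTree α
  | .inl a => leaf a
  | .inr (a, b) => node (leaf a) (leaf b)

/-- Every pair that hangs off the left branch is absorbed into the branch by one left rotation, and
the rotations for different pairs use disjoint pairs of nodes. -/
theorem simRot_spine (t t' : BinTree α) (h : SimRot t t') (L : List (α ⊕ α × α)) :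
    SimRot (L.foldl (fun u a => node u (small a)) t)
      (spine t' (L.flatMap fun a => (small a).leaves)) := by
  induction L generalizing t t' with
  | nil => simpa [spine] using h
  | cons a L ih =>
    rcases a with a | ⟨a, b⟩
    · exact ih _ _ (.node h (.leaf a))
    · exact ih _ _ (.left h (.leaf a) (.leaf b))

/-- The mirror image of a tree. -/
def mirror : BinTree α → BinTree α
  | leaf a => leaf a
  | node l r => node r.mirror l.mirror

theorem mirror_mirror (t : BinTree α) : t.mirror.mirror = t := by
  induction t with
  | leaf => rfl
  | node l r h1 h2 => simp [mirror, h1, h2]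

theorem count_mirror (t : BinTree α) : t.mirror.count = t.count := by
  induction t with
  | leaf => rfl
  | node l r h1 h2 => simp [mirror, count, h1, h2, add_comm]

theorem SimRot.mirror {t t' : BinTree α} (h : SimRot t t') : SimRot t.mirror t'.mirror := by
  induction h with
  | leaf a => exact .leaf a
  | node _ _ h1 h2 => exact .node h2 h1
  | left _ _ _ h1 h2 h3 => exact .right h3 h2 h1
  | right _ _ _ h1 h2 h3 => exact .left h3 h2 h1

theorem SimRots.mirror {k : ℕ} {t u : BinTree α} (h : SimRots k t u) :
    SimRots k t.mirror u.mirror := by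
  induction k generalizing t with
  | zero => rw [show t = u from h]; rfl
  | succ j ih =>
    obtain ⟨x, hx, hy⟩ := h
    exact ⟨_, hx.mirror, ih hy⟩

/-- A tree can be contracted to `s` (at the cost of two simultaneous rotations) by collapsing
pairs of sibling leaves. -/
def ContractsTo (t : BinTree α) (s : BinTree (α ⊕ α × α)) : Prop := SimRots 2 t (s.bind small)

theorem ContractsTo.node {t t' : BinTree α} {s s' : BinTree (α ⊕ α × α)} (h : ContractsTo t s)
    (h' : ContractsTo t' s') : ContractsTo (node t t') (node s s') :=
  SimRots.node h h'

theorem contractsTo_leaf (a : α) : ContractsTo (leaf a) (leaf (.inl a)) := SimRots.refl 2 _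

theorem contractsTo_pair (a b : α) :
    ContractsTo (node (leaf a) (leaf b)) (leaf (.inr (a, b))) := SimRots.refl 2 _

theorem ContractsTo.pair_left {t : BinTree α} {s : BinTree (α ⊕ α × α)} (a b : α)
    (h : ContractsTo t s) :
    ContractsTo (.node (leaf a) (.node (leaf b) t)) (.node (leaf (.inr (a, b))) s) := by
  obtain ⟨x, hx, y, hy, rfl⟩ := h
  exact ⟨_, .left (.leaf a) (.leaf b) hx, _, .node (.refl _) hy, rfl⟩

/-- The leaves `a` and `b` become siblings after two rotations, a right one below and then a left
one at the top. This is the case that requires the `2` in `ContractsTo`; the rotations of `t` take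
place at the same time. -/
theorem ContractsTo.pair_zigzag {t : BinTree α} {s : BinTree (α ⊕ α × α)} (a b c : α)
    (h : ContractsTo t s) :
    ContractsTo (.node (leaf a) (.node (.node (leaf b) t) (leaf c)))
      (.node (leaf (.inr (a, b))) (.node s (leaf (.inl c)))) := by
  obtain ⟨x, hx, y, hy, rfl⟩ := h
  exact ⟨_, .node (.leaf a) (.right (.leaf b) hx (.leaf c)), _,
    .left (.leaf a) (.leaf b) (.node hy (.leaf c)), rfl⟩

theorem ContractsTo.pair_right {t : BinTree α} {s : BinTree (α ⊕ α × α)} (b c : α)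
    (h : ContractsTo t s) :
    ContractsTo (.node (.node t (leaf b)) (leaf c)) (.node s (leaf (.inr (b, c)))) := by
  obtain ⟨x, hx, y, hy, rfl⟩ := h
  exact ⟨_, .right hx (.leaf b) (.leaf c), _, .node hy (.refl _), rfl⟩

/-- The label of a leaf or pair of leaves in the mirror image. -/
def swapSmall : α ⊕ α × α → α ⊕ α × α := Sum.map id Prod.swap

theorem mirror_bind_small (s : BinTree (α ⊕ α × α)) :
    (s.bind small).mirror = (s.mirror.bind fun a => leaf (swapSmall a)).bind small := by
  induction s with
  | leaf a => rcases a with a | ⟨a, b⟩ <;> rfl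
  | node l r h1 h2 => simp only [BinTree.bind, mirror, h1, h2]

theorem count_bind_leaf (f : α → β) (s : BinTree α) :
    (s.bind fun a => leaf (f a)).count = s.count := by
  induction s with
  | leaf a => rfl
  | node l r h1 h2 => simp only [BinTree.bind, count, h1, h2]

theorem ContractsTo.mirror {t : BinTree α} {s : BinTree (α ⊕ α × α)} (h : ContractsTo t s) :
    ContractsTo t.mirror (s.mirror.bind fun a => leaf (swapSmall a)) := by
  have h1 := SimRots.mirror h
  rw [mirror_bind_small] at h1
  exact h1

/-- A constant proportion of the leaves disappears in a suitable contraction of `t`. -/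
def Contractible (t : BinTree α) : Prop :=
  ∃ s, ContractsTo t s ∧ 6 * s.count + 2 ≤ 5 * t.count

theorem Contractible.of_mirror {t : BinTree α} (h : Contractible t.mirror) : Contractible t := by
  obtain ⟨s, h1, h2⟩ := h
  have h3 := h1.mirror
  rw [mirror_mirror] at h3
  refine ⟨_, h3, ?_⟩
  rwa [count_bind_leaf, count_mirror, ← count_mirror t]

/-- Count the gain `5 * t.count - 6 * s.count`, which has to be at least 2: a collapsed pair gains
4, a leaf left alone loses 1, and a subtree covered by `ih` gains at least 2. The single leaf `a` is
either paired with a leaf close to it or paid for by what lies below. The cases where `z` is a leaf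
and the two subtrees of `y` are both leaves (4 - 2) or both larger (2 + 2 - 2) are tight. -/
theorem contractible_leaf_node (a : α) (y z : BinTree α)
    (ih : ∀ t : BinTree α, 2 ≤ t.count → t.count < (node y z).count → Contractible t)
    (h : Contractible (node y z)) :
    Contractible (node (leaf a) (node y z)) := by
  have hy := count_pos y
  have hz := count_pos z
  simp only [count] at ih
  rcases y with b | ⟨y1, y2⟩
  · rcases z with c | ⟨z1, z2⟩
    · exact ⟨_, (contractsTo_leaf a).node (contractsTo_pair b c), by simp [count]⟩
    · have h1 := count_pos z1
      have h2 := count_pos z2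
      obtain ⟨s, hs, hc⟩ := ih (node z1 z2) (by simp only [count]; omega)
        (by simp only [count]; omega)
      exact ⟨_, hs.pair_left a b, by simp only [count] at *; omega⟩
  · have hy1 := count_pos y1
    have hy2 := count_pos y2
    rcases z with c | ⟨z1, z2⟩
    · rcases y1 with b | ⟨x1, x2⟩
      · rcases y2 with d | ⟨w1, w2⟩
        · exact ⟨_, (contractsTo_leaf a).node ((contractsTo_pair b d).node (contractsTo_leaf c)),
            by simp [count]⟩
        · have h1 := count_pos w1
          have h2 := count_pos w2
          obtain ⟨s, hs, hc⟩ := ih (node w1 w2) (by simp only [count]; omega)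
            (by simp only [count]; omega)
          exact ⟨_, hs.pair_zigzag a b c, by simp only [count] at *; omega⟩
      · have h1 := count_pos x1
        have h2 := count_pos x2
        obtain ⟨s, hs, hc⟩ := ih (node x1 x2) (by simp only [count]; omega)
          (by simp only [count]; omega)
        rcases y2 with d | ⟨w1, w2⟩
        · exact ⟨_, (contractsTo_leaf a).node (hs.pair_right d c),
            by simp only [count] at *; omega⟩
        · have h3 := count_pos w1
          have h4 := count_pos w2
          obtain ⟨s', hs', hc'⟩ := ih (node w1 w2) (by simp only [count]; omega)
            (by simp only [count]; omega)
          exact ⟨_, (contractsTo_leaf a).node ((hs.node hs').node (contractsTo_leaf c)),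
            by simp only [count] at *; omega⟩
    · have h1 := count_pos z1
      have h2 := count_pos z2
      obtain ⟨s, hs, hc⟩ := ih (node y1 y2) (by simp only [count]; omega)
        (by simp only [count]; omega)
      obtain ⟨s', hs', hc'⟩ := ih (node z1 z2) (by simp only [count]; omega)
        (by simp only [count]; omega)
      exact ⟨_, (contractsTo_leaf a).node (hs.node hs'), by simp only [count] at *; omega⟩

/-- Two subtrees with at least two leaves each are contracted independently; a single leaf on one
side is the subject of `contractible_leaf_node`, up to reflection. -/
theorem contractible (t : BinTree α) (ht : 2 ≤ t.count) : Contractible t := by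
  induction hk : t.count using Nat.strong_induction_on generalizing t with
  | _ k ih =>
    subst hk
    replace ih : ∀ u : BinTree α, 2 ≤ u.count → u.count < t.count → Contractible u :=
      fun u h1 h2 => ih _ h2 u h1 rfl
    rcases t with a | ⟨l, r⟩
    · simp [count] at ht
    have hl := count_pos l
    have hr := count_pos r
    simp only [count] at ih
    rcases l with a | ⟨l1, l2⟩
    · rcases r with b | ⟨r1, r2⟩
      · exact ⟨_, contractsTo_pair a b, by simp [count]⟩
      · have h1 := count_pos r1
        have h2 := count_pos r2
        exact contractible_leaf_node a r1 r2
          (fun t h1 h2 => ih t h1 (by simp only [count] at *; omega))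
          (ih _ (by simp only [count]; omega) (by simp only [count]; omega))
    · have h1 := count_pos l1
      have h2 := count_pos l2
      rcases r with b | ⟨r1, r2⟩
      · refine Contractible.of_mirror (contractible_leaf_node b l2.mirror l1.mirror
          (fun t h1 h2 => ih t h1 (by simp only [count, count_mirror] at *; omega))
          (ih _ ?_ ?_)) <;> simp only [count, count_mirror] <;> omega
      · have h3 := count_pos r1
        have h4 := count_pos r2
        obtain ⟨s, hs, hc⟩ := ih (node l1 l2) (by simp only [count]; omega)
          (by simp only [count]; omega)
        obtain ⟨s', hs', hc'⟩ := ih (node r1 r2) (by simp only [count]; omega)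
          (by simp only [count]; omega)
        exact ⟨_, hs.node hs', by simp only [count] at *; omega⟩

/-- A tree with few leaves is close to a comb. -/
theorem simRots_comb (j : ℕ) (t : BinTree α) (h : t.count * 5 ^ j ≤ 6 ^ j) :
    ∃ u, comb t.leaves = some u ∧ SimRots (3 * j) t u := by
  induction j generalizing α with
  | zero =>
    rcases t with a | ⟨l, r⟩
    · exact ⟨_, rfl, rfl⟩
    · have h1 := count_pos l
      have h2 := count_pos r
      simp only [count] at h
      omega
  | succ j ih =>
    rcases Nat.lt_or_ge t.count 2 with hc | hc
    · rcases t with a | ⟨l, r⟩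
      · exact ⟨_, rfl, SimRots.refl _ _⟩
      · have h1 := count_pos l
        have h2 := count_pos r
        simp only [count] at hc
        omega
    · obtain ⟨s, hs, hsc⟩ := contractible t hc
      -- The contracted tree has at most 5/6 of the leaves, hence satisfies the hypothesis for `j`.
      obtain ⟨u, hu, hr⟩ := ih s (by
        have : 6 * s.count * 5 ^ j ≤ 5 * t.count * 5 ^ j := Nat.mul_le_mul_right _ (by omega)
        rw [pow_succ, pow_succ] at h
        nlinarith)
      have hl : t.leaves = s.leaves.flatMap fun a => (small a).leaves := by
        rw [← leaves_bind, SimRots.leaves_eq hs]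
      have h2 := hr.bind small
      rcases hL : s.leaves with _ | ⟨a, L⟩
      · rw [hL] at hu; cases hu
      rw [hL] at hu
      obtain rfl : spine (leaf a) L = u := Option.some.inj hu
      rw [bind_spine] at h2
      -- Expanding the collapsed pairs turns the comb of `s` into a left branch with leaves and
      -- pairs attached; one more rotation straightens it. A round thus costs `2 + 1` rotations.
      have h3 := fun w h => simRot_spine (small a) w h L
      have h4 : ∃ w, comb t.leaves = some w ∧ SimRot ((L.foldl (fun u a => BinTree.node u (small a))
          ((leaf a).bind small))) w := by
        rw [hl, hL]
        rcases a with a | ⟨a, b⟩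
        · exact ⟨_, rfl, h3 _ (.refl _)⟩
        · exact ⟨_, rfl, h3 _ (.refl _)⟩
      obtain ⟨w, hw, hw'⟩ := h4
      refine ⟨w, hw, ?_⟩
      have := (SimRots.trans hs h2).trans hw'.simRots
      rwa [show 2 + 3 * j + 1 = 3 * (j + 1) by ring] at this

theorem exists_simRots (j : ℕ) (t t' : BinTree α) (hl : t.leaves = t'.leaves)
    (h : t.count * 5 ^ j ≤ 6 ^ j) : SimRots (6 * j) t t' := by
  obtain ⟨u, hu, h1⟩ := simRots_comb j t h
  obtain ⟨u', hu', h2⟩ := simRots_comb j t' (by rwa [← length_leaves, ← hl, length_leaves])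
  rw [hl, hu'] at hu
  cases hu
  have := h1.trans h2.symm
  rwa [show 3 * j + 3 * j = 6 * j by ring] at this

end BinTree

/-! ### Orbit counts -/

theorem orbitCount_eq_of_labels {D A : Type} (f : Perm D) (v : D → A)
    (hv : ∀ d d', v d = v d' ↔ f.SameCycle d d') (hs : Function.Surjective v) :
    orbitCount f = Nat.card A := by
  refine Nat.card_congr (Equiv.ofBijective
    (Quotient.lift v fun a b h => (hv a b).2 h : Quotient (Perm.SameCycle.setoid f) → A) ⟨?_, ?_⟩)
  · rintro ⟨a⟩ ⟨b⟩ h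
    exact Quotient.sound ((hv a b).1 h)
  · intro a
    obtain ⟨d, rfl⟩ := hs a
    exact ⟨Quotient.mk _ d, rfl⟩

theorem card_eq_sum_fibers {D : Type} [Fintype D] [DecidableEq D] (f : Perm D)
    [Fintype (Quotient (Perm.SameCycle.setoid f))]
    [DecidableEq (Quotient (Perm.SameCycle.setoid f))] :
    Fintype.card D = ∑ q : Quotient (Perm.SameCycle.setoid f),
      (Finset.univ.filter fun d => (Quotient.mk _ d : Quotient (Perm.SameCycle.setoid f)) = q).card := by
  rw [← Finset.card_univ]
  exact Finset.card_eq_sum_card_fiberwise fun _ _ => Finset.mem_coe.2 (Finset.mem_univ _)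

theorem sameCycle_iff_of_involutive {D : Type} {f : Perm D} (h : ∀ d, f (f d) = d) (d x : D) :
    f.SameCycle d x ↔ x = d ∨ x = f d := by
  constructor
  · rintro ⟨i, rfl⟩
    induction i using Int.induction_on with
    | zero => simp
    | succ i ih =>
      rw [add_comm, zpow_add, zpow_one, Perm.mul_apply]
      rcases ih with ih | ih <;> rw [ih] <;> simp [h]
    | pred i ih =>
      have h' : ∀ d, f⁻¹ d = f d := fun d => by rw [Perm.inv_eq_iff_eq, h]
      rw [sub_eq_add_neg, add_comm, zpow_add, zpow_neg_one, Perm.mul_apply]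
      rcases ih with ih | ih <;> rw [ih, h'] <;> simp [h]
  · rintro (rfl | rfl)
    · exact .refl _ _
    · exact ⟨1, by simp⟩

theorem sameCycle_iff_of_order_three {D : Type} {f : Perm D} (h : ∀ d, f (f (f d)) = d) (d x : D) :
    f.SameCycle d x ↔ x = d ∨ x = f d ∨ x = f (f d) := by
  constructor
  · rintro ⟨i, rfl⟩
    induction i using Int.induction_on with
    | zero => simp
    | succ i ih =>
      rw [add_comm, zpow_add, zpow_one, Perm.mul_apply]
      rcases ih with ih | ih | ih <;> rw [ih] <;> simp [h]
    | pred i ih =>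
      have h' : ∀ d, f⁻¹ d = f (f d) := fun d => by rw [Perm.inv_eq_iff_eq, h]
      rw [sub_eq_add_neg, add_comm, zpow_add, zpow_neg_one, Perm.mul_apply]
      rcases ih with ih | ih | ih <;> rw [ih, h'] <;> simp [h]
  · rintro (rfl | rfl | rfl)
    · exact .refl _ _
    · exact ⟨1, by simp⟩
    · exact ⟨2, by simp [zpow_ofNat, pow_two]⟩

theorem two_mul_orbitCount {D : Type} [Finite D] {f : Perm D} (h : ∀ d, f (f d) = d)
    (h' : ∀ d, f d ≠ d) : 2 * orbitCount f = Nat.card D := by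
  classical
  have := Fintype.ofFinite D
  have := Fintype.ofFinite (Quotient (Perm.SameCycle.setoid f))
  rw [orbitCount, Nat.card_eq_fintype_card, Nat.card_eq_fintype_card, card_eq_sum_fibers f,
    Finset.sum_const_nat (m := 2), Finset.card_univ, mul_comm]
  rintro ⟨d⟩ -
  have : (Finset.univ.filter fun x => (Quotient.mk _ x : Quotient (Perm.SameCycle.setoid f)) =
      Quotient.mk _ d) = {d, f d} := by
    ext x
    simp only [Finset.mem_filter, Finset.mem_univ, true_and, Finset.mem_insert,
      Finset.mem_singleton, Quotient.eq]
    rw [← sameCycle_iff_of_involutive h]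
    exact Perm.sameCycle_comm
  exact (congrArg Finset.card this).trans (Finset.card_pair (h' d).symm)

/-- All orbits have three elements except that of the fixed point `r`, which is two short. -/
theorem three_mul_orbitCount {D : Type} [Finite D] {f : Perm D} (h : ∀ d, f (f (f d)) = d)
    {r : D} (hr : f r = r) (h' : ∀ d, d ≠ r → f d ≠ d) : 3 * orbitCount f = Nat.card D + 2 := by
  classical
  have := Fintype.ofFinite D
  have := Fintype.ofFinite (Quotient (Perm.SameCycle.setoid f))
  have hf : ∀ q : Quotient (Perm.SameCycle.setoid f), (Finset.univ.filter fun x =>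
      (Quotient.mk _ x : Quotient (Perm.SameCycle.setoid f)) = q).card +
      (if q = Quotient.mk _ r then 2 else 0) = 3 := by
    rintro ⟨d⟩
    have hm : (Finset.univ.filter fun x => (Quotient.mk _ x : Quotient (Perm.SameCycle.setoid f)) =
        Quotient.mk _ d) = {d, f d, f (f d)} := by
      ext x
      simp only [Finset.mem_filter, Finset.mem_univ, true_and, Finset.mem_insert,
        Finset.mem_singleton, Quotient.eq]
      rw [← sameCycle_iff_of_order_three h]
      exact Perm.sameCycle_comm
    have hq : ((Quotient.mk _ d : Quotient (Perm.SameCycle.setoid f)) = Quotient.mk _ r) ↔ d = r := by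
      rw [Quotient.eq]
      refine (Perm.sameCycle_comm (f := f) (x := d) (y := r)).trans ?_
      rw [sameCycle_iff_of_order_three h]
      simp [hr]
    change (Finset.univ.filter fun x => (Quotient.mk _ x : Quotient (Perm.SameCycle.setoid f)) =
        Quotient.mk _ d).card + (if (Quotient.mk _ d : Quotient (Perm.SameCycle.setoid f)) =
        Quotient.mk _ r then 2 else 0) = 3
    rw [hm]
    by_cases hd : d = r
    · rw [if_pos (hq.2 hd), hd, hr, hr]; simp
    · rw [if_neg (mt hq.1 hd)]
      have h1 := h' d hd
      have h2 : f (f d) ≠ f d := fun e => h1 (f.injective e)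
      have h3 : f (f d) ≠ d := fun e => h1 (by have := h d; rw [e] at this; exact this)
      rw [Finset.card_insert_of_notMem (by simp [h1.symm, h3.symm]), Finset.card_pair h2.symm]
  have hsum := Finset.sum_congr (rfl : (Finset.univ : Finset (Quotient (Perm.SameCycle.setoid f)))
    = Finset.univ) fun q _ => hf q
  rw [Finset.sum_add_distrib, ← card_eq_sum_fibers f, Finset.sum_ite_eq' , Finset.sum_const] at hsum
  rw [orbitCount, Nat.card_eq_fintype_card, Nat.card_eq_fintype_card]
  simp only [Finset.mem_univ, if_true, Finset.card_univ, smul_eq_mul] at hsum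
  omega

/-! ### Simultaneous flips of triangulations -/

namespace Triangulation

variable {n : ℕ} {D : Type}

/-- There are `n + 1` vertices, `Nat.card D / 2` edges and `(Nat.card D + 2) / 3` faces including
the outer one; Euler's formula determines the number of darts. -/
theorem card_darts [Finite D] (T : Triangulation n D) : Nat.card D + 2 = 6 * n := by
  have h1 := two_mul_orbitCount T.opp_opp T.opp_ne
  have h2 := three_mul_orbitCount T.next_next_next T.next_root T.next_ne
  have h3 := orbitCount_eq_of_labels _ _ T.vert_eq_iff T.vert_surjective
  have h4 := T.euler
  simp only [Nat.card_eq_fintype_card, Fintype.card_option, Fintype.card_fin] at h3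
  omega

theorem vert_next_opp (T : Triangulation n D) (d : D) : T.vert (T.next (T.opp d)) = T.vert d :=
  ((T.vert_eq_iff _ _).2 ⟨1, by simp⟩).symm

theorem vert_next (T : Triangulation n D) (d : D) : T.vert (T.next d) = T.vert (T.opp d) := by
  rw [← T.vert_next_opp (T.opp d), T.opp_opp]

/-- The darts of arcs that can be flipped simultaneously. -/
structure Flippable (T : Triangulation n D) (S : Set D) : Prop where
  root : T.root ∉ S
  opp : ∀ d ∈ S, T.opp d ∈ S
  next : ∀ d ∈ S, T.next d ∉ S
  next_next : ∀ d ∈ S, T.next (T.next d) ∉ S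

open Classical in
/-- The successor of a dart after a simultaneous flip. -/
noncomputable def flipNext (T : Triangulation n D) (S : Set D) (d : D) : D :=
  if d ∈ S then T.next (T.next (T.opp d))
  else if T.next d ∈ S then T.next (T.opp (T.next d))
  else if T.next (T.next d) ∈ S then T.next (T.next d)
  else T.next d

open Classical in
/-- The labels after a simultaneous flip. -/
noncomputable def flipVert (T : Triangulation n D) (S : Set D) (d : D) : Option (Fin n) :=
  if d ∈ S then T.vert (T.next (T.next d)) else T.vert d

end Triangulation

namespace Triangulation

variable {n : ℕ} {D : Type}

theorem Flippable.opp_notMem {T : Triangulation n D} {S : Set D} (h : T.Flippable S) {d : D}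
    (hd : d ∉ S) : T.opp d ∉ S := fun hs => hd (by
  have := h.opp _ hs
  rwa [T.opp_opp] at this)

section flipNext

variable {T : Triangulation n D} {S : Set D}

theorem Flippable.notMem_of_next (h : T.Flippable S) {d : D} (hd : T.next d ∈ S) : d ∉ S :=
  fun hs => h.next d hs hd

theorem Flippable.notMem_of_next_next (h : T.Flippable S) {d : D} (hd : T.next (T.next d) ∈ S) :
    d ∉ S := fun hs => h.next_next d hs hd

theorem flipNext_mem {d : D} (hd : d ∈ S) : T.flipNext S d = T.next (T.next (T.opp d)) := by
  rw [flipNext, if_pos hd]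

theorem flipNext_next_mem (h : T.Flippable S) {d : D} (hd : T.next d ∈ S) :
    T.flipNext S d = T.next (T.opp (T.next d)) := by
  rw [flipNext, if_neg (h.notMem_of_next hd), if_pos hd]

theorem flipNext_next_next_mem (h : T.Flippable S) {d : D} (hd : T.next (T.next d) ∈ S) :
    T.flipNext S d = T.next (T.next d) := by
  rw [flipNext, if_neg (h.notMem_of_next_next hd), if_neg (h.notMem_of_next hd), if_pos hd]

theorem flipNext_notMem {d : D} (h1 : d ∉ S) (h2 : T.next d ∉ S) (h3 : T.next (T.next d) ∉ S) :
    T.flipNext S d = T.next d := by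
  rw [flipNext, if_neg h1, if_neg h2, if_neg h3]

theorem flipNext_flipNext_flipNext (h : T.Flippable S) (d : D) :
    T.flipNext S (T.flipNext S (T.flipNext S d)) = d := by
  by_cases h1 : d ∈ S
  · rw [flipNext_mem h1, flipNext_next_mem h (d := T.next (T.next (T.opp d)))
      (by rw [T.next_next_next]; exact h.opp _ h1), T.next_next_next, T.opp_opp,
      flipNext_next_next_mem h (by rwa [T.next_next_next]), T.next_next_next]
  by_cases h2 : T.next d ∈ S
  · have h4 := h.opp _ h2
    rw [flipNext_next_mem h h2, flipNext_next_next_mem h (d := T.next (T.opp (T.next d)))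
      (by rwa [T.next_next_next]), T.next_next_next, flipNext_mem h4, T.opp_opp, T.next_next_next]
  by_cases h3 : T.next (T.next d) ∈ S
  · have h4 := h.opp _ h3
    rw [flipNext_next_next_mem h h3, flipNext_mem h3, flipNext_next_mem h
      (d := T.next (T.next (T.opp (T.next (T.next d))))) (by rwa [T.next_next_next]),
      T.next_next_next, T.opp_opp, T.next_next_next]
  · rw [flipNext_notMem h1 h2 h3, flipNext_notMem h2 h3 (by rwa [T.next_next_next]),
      flipNext_notMem h3 (by rwa [T.next_next_next]) (by rwa [T.next_next_next]), T.next_next_next]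

/-- The successor permutation after a simultaneous flip. -/
noncomputable def flipPerm (h : T.Flippable S) : Perm D where
  toFun := T.flipNext S
  invFun d := T.flipNext S (T.flipNext S d)
  left_inv := flipNext_flipNext_flipNext h
  right_inv := flipNext_flipNext_flipNext h

theorem flipPerm_apply (h : T.Flippable S) (d : D) : flipPerm h d = T.flipNext S d := rfl

theorem flipNext_root (h : T.Flippable S) : T.flipNext S T.root = T.root := by
  have := h.root
  rw [flipNext_notMem] <;> simp [T.next_root, this]

theorem flipNext_ne (h : T.Flippable S) {d : D} (hd : d ≠ T.root) : T.flipNext S d ≠ d := by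
  by_cases h1 : d ∈ S
  · rw [flipNext_mem h1]
    intro e
    have := h.next_next _ (h.opp _ h1)
    rw [e] at this
    exact this h1
  by_cases h2 : T.next d ∈ S
  · rw [flipNext_next_mem h h2]
    intro e
    have h3 := h.next _ (h.opp _ h2)
    have h4 : T.next (T.next (T.opp (T.next d))) = T.opp (T.opp (T.next d)) := by
      rw [e, T.opp_opp]
    have h5 := h.next_next _ (h.opp _ h2)
    rw [h4, T.opp_opp] at h5
    exact h5 h2
  by_cases h3 : T.next (T.next d) ∈ S
  · rw [flipNext_next_next_mem h h3]
    intro e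
    rw [e] at h3
    exact h1 h3
  · rw [flipNext_notMem h1 h2 h3]
    exact T.next_ne d hd

theorem sameCycle_flip_step (h : T.Flippable S) (d : D) :
    (flipPerm h * T.opp).SameCycle d (T.flipNext S (T.opp d)) := ⟨1, by simp [flipPerm_apply]⟩

theorem sameCycle_flip_mem (h : T.Flippable S) {d : D} (hd : d ∈ S) :
    (flipPerm h * T.opp).SameCycle d (T.next (T.next d)) := by
  have := sameCycle_flip_step h d
  rwa [flipNext_mem (h.opp d hd), T.opp_opp] at this

theorem sameCycle_flip_notMem (h : T.Flippable S) {d : D} (hd : d ∉ S)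
    (hd' : T.next (T.opp d) ∉ S) : (flipPerm h * T.opp).SameCycle d (T.next (T.opp d)) := by
  have h1 := sameCycle_flip_step h d
  by_cases h3 : T.next (T.next (T.opp d)) ∈ S
  · rw [flipNext_next_next_mem h h3] at h1
    have h2 := sameCycle_flip_mem h h3
    rw [T.next_next_next] at h2
    exact h1.trans h2
  · rwa [flipNext_notMem (h.opp_notMem hd) hd' h3] at h1

theorem sameCycle_flip_of_next_mem (h : T.Flippable S) {d : D} (hd' : T.next (T.opp d) ∈ S) :
    (flipPerm h * T.opp).SameCycle d (T.next (T.opp (T.next (T.opp d)))) := by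
  have h1 := sameCycle_flip_step h d
  rwa [flipNext_next_mem h hd'] at h1

theorem self_inv_apply {D : Type} (f : Perm D) (x : D) : f (f⁻¹ x) = x := f.apply_symm_apply x

open Classical in
/-- A dart that is not flipped at the initial point of a given dart. -/
noncomputable def unflipped (T : Triangulation n D) (S : Set D) (d : D) : D :=
  if d ∈ S then T.next (T.opp d) else d

theorem unflipped_notMem (h : T.Flippable S) (d : D) : T.unflipped S d ∉ S := by
  unfold unflipped
  split_ifs with hd
  · exact h.next _ (h.opp _ hd)
  · exact hd

theorem vert_unflipped (d : D) : T.vert (T.unflipped S d) = T.vert d := by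
  unfold unflipped
  split_ifs with hd
  · exact T.vert_next_opp d
  · rfl

/-- Two consecutive darts about a point are sides of one triangle, so they are not both flipped.
Skipping the flipped darts therefore turns a turn about a point before the flip into at most one
step over a gap, which is a turn about the same point after the flip. -/
theorem sameCycle_unflipped_next (h : T.Flippable S) (d : D) :
    (flipPerm h * T.opp).SameCycle (T.unflipped S d) (T.unflipped S (T.next (T.opp d))) := by
  by_cases hd : d ∈ S
  · have h1 := h.next _ (h.opp _ hd)
    rw [unflipped, unflipped, if_pos hd, if_neg h1]
  · by_cases h1 : T.next (T.opp d) ∈ S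
    · rw [unflipped, unflipped, if_neg hd, if_pos h1]
      exact sameCycle_flip_of_next_mem h h1
    · rw [unflipped, unflipped, if_neg hd, if_neg h1]
      exact sameCycle_flip_notMem h hd h1

theorem sameCycle_of_forall_step {D : Type} {f g : Perm D} {r : D → D}
    (h : ∀ d, g.SameCycle (r d) (r (f d))) {d d' : D} (hd : f.SameCycle d d') :
    g.SameCycle (r d) (r d') := by
  obtain ⟨i, rfl⟩ := hd
  induction i using Int.induction_on with
  | zero => exact .refl _ _
  | succ i ih =>
    rw [add_comm, zpow_add, zpow_one, Perm.mul_apply]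
    exact ih.trans (h _)
  | pred i ih =>
    rw [sub_eq_add_neg, add_comm, zpow_add, zpow_neg_one, Perm.mul_apply]
    refine ih.trans ?_
    have := h (f⁻¹ ((f ^ (-(i : ℤ))) d))
    rw [self_inv_apply] at this
    exact this.symm

theorem eq_of_forall_step {D A : Type} {f : Perm D} {v : D → A} (h : ∀ d, v (f d) = v d) {d d' : D}
    (hd : f.SameCycle d d') : v d = v d' := by
  obtain ⟨i, rfl⟩ := hd
  induction i using Int.induction_on with
  | zero => simp
  | succ i ih => rw [add_comm, zpow_add, zpow_one, Perm.mul_apply, h, ← ih]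
  | pred i ih =>
    rw [sub_eq_add_neg, add_comm, zpow_add, zpow_neg_one, Perm.mul_apply, ih, ← h (f⁻¹ _),
      self_inv_apply]

theorem flipVert_of_mem {d : D} (hd : d ∈ S) : T.flipVert S d = T.vert (T.next (T.next d)) := by
  rw [flipVert, if_pos hd]

theorem flipVert_of_notMem {d : D} (hd : d ∉ S) : T.flipVert S d = T.vert d := by
  rw [flipVert, if_neg hd]

theorem flipVert_step (h : T.Flippable S) (d : D) :
    T.flipVert S (T.flipNext S (T.opp d)) = T.flipVert S d := by
  by_cases hd : d ∈ S
  · rw [flipVert_of_mem hd, flipNext_mem (h.opp _ hd), T.opp_opp,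
      flipVert_of_notMem (h.next_next _ hd)]
  have ho := h.opp_notMem hd
  rw [flipVert_of_notMem hd]
  by_cases h1 : T.next (T.opp d) ∈ S
  · rw [flipNext_next_mem h h1, flipVert_of_notMem (h.next _ (h.opp _ h1)), T.vert_next_opp,
      T.vert_next_opp]
  by_cases h2 : T.next (T.next (T.opp d)) ∈ S
  · rw [flipNext_next_next_mem h h2, flipVert_of_mem h2, T.next_next_next, T.vert_next_opp]
  · rw [flipNext_notMem ho h1 h2, flipVert_of_notMem h1, T.vert_next_opp]

theorem exists_sameCycle_notMem (h : T.Flippable S) (d : D) :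
    ∃ x, x ∉ S ∧ (flipPerm h * T.opp).SameCycle d x ∧ T.vert x = T.flipVert S d := by
  by_cases hd : d ∈ S
  · exact ⟨_, h.next_next _ hd, sameCycle_flip_mem h hd, (flipVert_of_mem hd).symm⟩
  · exact ⟨d, hd, .refl _ _, (flipVert_of_notMem hd).symm⟩

/-- The unflipped darts keep their labels and their vertices, and each flipped dart shares its new
vertex with an unflipped one. -/
theorem flipVert_eq_iff (h : T.Flippable S) (d d' : D) :
    T.flipVert S d = T.flipVert S d' ↔ (flipPerm h * T.opp).SameCycle d d' := by
  constructor
  · intro e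
    obtain ⟨x, hx, hdx, hv⟩ := exists_sameCycle_notMem h d
    obtain ⟨x', hx', hdx', hv'⟩ := exists_sameCycle_notMem h d'
    have h1 := (T.vert_eq_iff x x').1 (by rw [hv, hv', e])
    have h2 := sameCycle_of_forall_step (r := T.unflipped S) (sameCycle_unflipped_next h) h1
    rw [unflipped, unflipped, if_neg hx, if_neg hx'] at h2
    exact (hdx.trans h2).trans hdx'.symm
  · exact eq_of_forall_step (flipVert_step h)

/-- The old successor is locally a word in the new successor and `opp`, so connectedness survives
the flip. -/
theorem reach_next_flip (h : T.Flippable S) (d : D) :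
    ∃ g ∈ Subgroup.closure ({flipPerm h, T.opp} : Set (Perm D)), g d = T.next d := by
  have hn : flipPerm h ∈ Subgroup.closure ({flipPerm h, T.opp} : Set (Perm D)) :=
    Subgroup.subset_closure (by simp)
  have ho : T.opp ∈ Subgroup.closure ({flipPerm h, T.opp} : Set (Perm D)) :=
    Subgroup.subset_closure (by simp)
  by_cases h1 : d ∈ S
  · refine ⟨(flipPerm h)⁻¹, inv_mem hn, ?_⟩
    rw [Perm.inv_eq_iff_eq, flipPerm_apply, flipNext_next_next_mem h (by rwa [T.next_next_next]),
      T.next_next_next]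
  by_cases h2 : T.next d ∈ S
  · refine ⟨T.opp⁻¹ * (flipPerm h)⁻¹, mul_mem (inv_mem ho) (inv_mem hn), ?_⟩
    rw [Perm.mul_apply, Perm.inv_eq_iff_eq, Perm.inv_eq_iff_eq, flipPerm_apply,
      flipNext_mem (h.opp _ h2), T.opp_opp, T.next_next_next]
  by_cases h3 : T.next (T.next d) ∈ S
  · refine ⟨flipPerm h * T.opp * flipPerm h, mul_mem (mul_mem hn ho) hn, ?_⟩
    rw [Perm.mul_apply, Perm.mul_apply, flipPerm_apply, flipPerm_apply,
      flipNext_next_next_mem h h3, flipNext_mem (h.opp _ h3), T.opp_opp, T.next_next_next]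
  · exact ⟨_, hn, by rw [flipPerm_apply, flipNext_notMem h1 h2 h3]⟩

theorem connected_of_reach {D : Type} {f g o : Perm D}
    (hc : ∀ d d', ∃ k ∈ Subgroup.closure ({f, o} : Set (Perm D)), k d = d')
    (hr : ∀ d, ∃ k ∈ Subgroup.closure ({g, o} : Set (Perm D)), k d = f d) (d d' : D) :
    ∃ k ∈ Subgroup.closure ({g, o} : Set (Perm D)), k d = d' := by
  obtain ⟨k, hk, rfl⟩ := hc d d'
  induction hk using Subgroup.closure_induction generalizing d with
  | mem x hx =>
    rcases hx with rfl | rfl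
    · exact hr d
    · exact ⟨_, Subgroup.subset_closure (by simp), rfl⟩
  | one => exact ⟨1, one_mem _, rfl⟩
  | mul x y _ _ hx hy =>
    obtain ⟨k, hk, hkd⟩ := hy d
    obtain ⟨k', hk', hkd'⟩ := hx (y d)
    exact ⟨k' * k, mul_mem hk' hk, by rw [Perm.mul_apply, hkd, hkd', Perm.mul_apply]⟩
  | inv x _ hx =>
    obtain ⟨k, hk, hkd⟩ := hx (x⁻¹ d)
    rw [self_inv_apply] at hkd
    exact ⟨k⁻¹, inv_mem hk, by rw [Perm.inv_eq_iff_eq, hkd]⟩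

/-- The triangulation that arises by a simultaneous flip. -/
noncomputable def flip [Finite D] (T : Triangulation n D) {S : Set D} (h : T.Flippable S) :
    Triangulation n D where
  next := flipPerm h
  opp := T.opp
  root := T.root
  vert := T.flipVert S
  opp_opp := T.opp_opp
  opp_ne := T.opp_ne
  next_root := flipNext_root h
  next_ne _ hd := flipNext_ne h hd
  next_next_next := flipNext_flipNext_flipNext h
  connected := connected_of_reach T.connected (reach_next_flip h)
  vert_eq_iff := flipVert_eq_iff h
  vert_surjective w := by
    obtain ⟨d, rfl⟩ := T.vert_surjective w
    exact ⟨T.unflipped S d, by rw [flipVert_of_notMem (unflipped_notMem h d), vert_unflipped]⟩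
  vert_root := by rw [flipVert_of_notMem h.root, T.vert_root]
  euler := by
    have hv : Function.Surjective (T.flipVert S) := fun w => by
      obtain ⟨d, rfl⟩ := T.vert_surjective w
      exact ⟨T.unflipped S d, by rw [flipVert_of_notMem (unflipped_notMem h d), vert_unflipped]⟩
    -- Vertices are counted by the labels and faces by the darts, so neither number changes under
    -- the flip.
    have h1 := orbitCount_eq_of_labels _ _ (flipVert_eq_iff h) hv
    have h2 := orbitCount_eq_of_labels _ _ T.vert_eq_iff T.vert_surjective
    have h3 := three_mul_orbitCount T.next_next_next T.next_root T.next_ne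
    have h4 := three_mul_orbitCount (f := flipPerm h) (flipNext_flipNext_flipNext h)
      (flipNext_root h) (fun _ hd => flipNext_ne h hd)
    have h5 := T.euler
    omega

theorem flipAlong_flip [Finite D] (T : Triangulation n D) {S : Set D} (h : T.Flippable S) :
    FlipAlong S T (T.flip h) := by
  refine ⟨h.root, fun d hd => ⟨h.opp d hd, h.next d hd, h.next_next d hd⟩, rfl,
    fun d hd => ⟨?_, ?_, ?_⟩, fun d h1 h2 h3 => ?_, fun d hd => ?_, fun d hd => ?_⟩
  · have := flipNext_next_next_mem h (d := T.next d) (by rwa [T.next_next_next])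
    rwa [T.next_next_next] at this
  · exact flipNext_mem hd
  · have := flipNext_next_mem h (d := T.next (T.next d)) (by rwa [T.next_next_next])
    rwa [T.next_next_next] at this
  · exact flipNext_notMem h1 h2 h3
  · exact flipVert_of_mem hd
  · exact flipVert_of_notMem hd

end flipNext

end Triangulation

/-! ### Developments, and flips that realize rotations -/

namespace Triangulation

variable {n : ℕ} {D α : Type}

/-- The darts, other than `d`, of the triangles that are met when the triangles behind the dart `d`
are developed according to the shape of a tree: a node stands for a triangle that is entered
through its side `opp d` and left through its other two sides. -/
def inner (T : Triangulation n D) : D → BinTree α → List D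
  | _, .leaf _ => []
  | d, .node l r => T.opp d :: T.next (T.opp d) :: T.next (T.next (T.opp d)) ::
      (T.inner (T.next (T.opp d)) l ++ T.inner (T.next (T.next (T.opp d))) r)

/-- The darts at the leaves of a development. -/
def leafDarts (T : Triangulation n D) : D → BinTree α → List D
  | d, .leaf _ => [d]
  | d, .node l r =>
      T.leafDarts (T.next (T.opp d)) l ++ T.leafDarts (T.next (T.next (T.opp d))) r

theorem next_mem_inner (T : Triangulation n D) {d z : D} {t : BinTree α} (h : z ∈ T.inner d t) :
    T.next z ∈ T.inner d t := by
  induction t generalizing d with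
  | leaf a => simp [inner] at h
  | node l r hl hr =>
    simp only [inner, List.mem_cons, List.mem_append] at h ⊢
    rcases h with rfl | rfl | rfl | h | h
    · simp
    · simp
    · simp [T.next_next_next]
    · exact Or.inr (Or.inr (Or.inr (Or.inl (hl h))))
    · exact Or.inr (Or.inr (Or.inr (Or.inr (hr h))))

theorem mem_inner_of_mem_leafDarts (T : Triangulation n D) {d z : D} {t : BinTree α}
    (h : z ∈ T.leafDarts d t) : z = d ∨ z ∈ T.inner d t := by
  induction t generalizing d with
  | leaf a => exact Or.inl (by simpa [leafDarts] using h)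
  | node l r hl hr =>
    simp only [leafDarts, inner, List.mem_cons, List.mem_append] at h ⊢
    rcases h with h | h
    · rcases hl h with rfl | h
      · simp
      · simp [h]
    · rcases hr h with rfl | h
      · simp
      · simp [h]

/-- A simultaneous rotation of the shape `t` of the development behind `d` into `t'` is realized
by a simultaneous flip along a set of darts. -/
def Realizes (T : Triangulation n D) (d : D) (t t' : BinTree α) : Prop :=
  ∃ S : Set D, (∀ x ∈ S, x ∈ T.inner d t) ∧ T.opp d ∉ S ∧
    (∀ x ∈ S, T.opp x ∈ S ∧ T.next x ∉ S ∧ T.next (T.next x) ∉ S) ∧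
    (∀ x ∈ T.leafDarts d t, x = d ∨ x ∉ S) ∧
    ∀ (T' : Triangulation n D) (R : Set D), FlipAlong R T T' →
      (∀ x ∈ T.inner d t, x ∈ R ↔ x ∈ S) →
      (T'.inner d t').Perm (T.inner d t) ∧ T'.leafDarts d t' = T.leafDarts d t

/-- The two subtrees involve disjoint sets of triangles, so the union of their flip sets works. To
permit this, `Realizes` speaks of all flips along sets that agree with `S` on the darts of the
development, whatever they do elsewhere. -/
theorem realizes_node (T : Triangulation n D) {a a' b b' : BinTree α} (d : D)
    (iha : ∀ d, (T.inner d a).Nodup → T.Realizes d a a')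
    (ihb : ∀ d, (T.inner d b).Nodup → T.Realizes d b b')
    (hd : (T.inner d (.node a b)).Nodup) : T.Realizes d (.node a b) (.node a' b') := by
  have hnd := hd
  simp only [inner, List.nodup_cons, List.nodup_append, List.mem_cons, List.mem_append,
    not_or] at hd
  obtain ⟨⟨h1, h2, h3, h4⟩, ⟨h5, h6, h7⟩, ⟨h8, h9⟩, ha, hb, hdis⟩ := hd
  obtain ⟨S, hS, hoS, hcS, hlS, hTS⟩ := iha _ ha
  obtain ⟨R, hR, hoR, hcR, hlR, hTR⟩ := ihb _ hb
  refine ⟨S ∪ R, ?_, ?_, ?_, ?_, ?_⟩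
  · rintro x (hx | hx)
    · simp [inner, hS x hx]
    · simp [inner, hR x hx]
  · rintro (hx | hx)
    · exact h3 (hS _ hx)
    · exact h4 (hR _ hx)
  · rintro x (hx | hx)
    · have e1 := T.next_mem_inner (hS x hx)
      have e2 := T.next_mem_inner e1
      exact ⟨Or.inl (hcS x hx).1, fun e => e.elim (hcS x hx).2.1 fun e => hdis _ e1 _ (hR _ e) rfl,
        fun e => e.elim (hcS x hx).2.2 fun e => hdis _ e2 _ (hR _ e) rfl⟩
    · have e1 := T.next_mem_inner (hR x hx)
      have e2 := T.next_mem_inner e1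
      exact ⟨Or.inr (hcR x hx).1, fun e => e.elim (fun e => hdis _ (hS _ e) _ e1 rfl) (hcR x hx).2.1,
        fun e => e.elim (fun e => hdis _ (hS _ e) _ e2 rfl) (hcR x hx).2.2⟩
  · intro x hx
    right
    rcases List.mem_append.1 hx with hx | hx
    · rcases T.mem_inner_of_mem_leafDarts hx with rfl | hx'
      · exact fun e => e.elim (fun e => h6 (hS _ e)) fun e => h7 (hR _ e)
      · rcases hlS x hx with rfl | hxS
        · exact absurd hx' h6
        · exact fun e => e.elim hxS fun e => hdis _ hx' _ (hR _ e) rfl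
    · rcases T.mem_inner_of_mem_leafDarts hx with rfl | hx'
      · exact fun e => e.elim (fun e => h8 (hS _ e)) fun e => h9 (hR _ e)
      · rcases hlR x hx with rfl | hxR
        · exact absurd hx' h9
        · exact fun e => e.elim (fun e => hdis _ (hS _ e) _ hx' rfl) hxR
  · intro T' Q hQ hQS
    have hQ' := hQ
    obtain ⟨-, -, ho, -, hn, -, -⟩ := hQ
    have n1 : T.opp d ∉ Q := by
      rw [hQS _ (by simp [inner])]
      exact fun e => e.elim (fun e => h3 (hS _ e)) fun e => h4 (hR _ e)
    have n2 : T.next (T.opp d) ∉ Q := by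
      rw [hQS _ (by simp [inner])]
      exact fun e => e.elim (fun e => h6 (hS _ e)) fun e => h7 (hR _ e)
    have n3 : T.next (T.next (T.opp d)) ∉ Q := by
      rw [hQS _ (by simp [inner])]
      exact fun e => e.elim (fun e => h8 (hS _ e)) fun e => h9 (hR _ e)
    -- No side of the triangle at the root of the development is flipped, so this triangle stays as
    -- it is.
    have e1 := hn _ n1 n2 n3
    have e2 := hn _ n2 n3 (by rwa [T.next_next_next])
    obtain ⟨p1, q1⟩ := hTS T' Q hQ' fun x hx => by
      rw [hQS x (by simp [inner, hx])]
      exact ⟨fun e => e.elim id fun e => (hdis _ hx _ (hR _ e) rfl).elim, Or.inl⟩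
    obtain ⟨p2, q2⟩ := hTR T' Q hQ' fun x hx => by
      rw [hQS x (by simp [inner, hx])]
      exact ⟨fun e => e.elim (fun e => (hdis _ (hS _ e) _ hx rfl).elim) id, Or.inr⟩
    simp only [inner, leafDarts, ho, e1, e2, q1, q2, and_true]
    exact ((p1.append p2).cons _).cons _ |>.cons _

-- The two nodes of the rotation are triangles with a common side, whose darts are `y` and `z` in
-- the proof. Flipping it along with the flip sets of the three subtrees is allowed because the
-- darts of the development are distinct.
set_option maxHeartbeats 1000000 in
theorem realizes_left (T : Triangulation n D) {a a' b b' c c' : BinTree α} (d : D)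
    (iha : ∀ d, (T.inner d a).Nodup → T.Realizes d a a')
    (ihb : ∀ d, (T.inner d b).Nodup → T.Realizes d b b')
    (ihc : ∀ d, (T.inner d c).Nodup → T.Realizes d c c')
    (hd : (T.inner d (.node a (.node b c))).Nodup) :
    T.Realizes d (.node a (.node b c)) (.node (.node a' b') c') := by
  simp only [inner] at hd
  obtain ⟨e, he⟩ : ∃ e, e = T.opp d := ⟨_, rfl⟩
  obtain ⟨y, hy⟩ : ∃ y, y = T.next (T.next e) := ⟨_, rfl⟩
  obtain ⟨z, hz⟩ : ∃ z, z = T.opp y := ⟨_, rfl⟩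
  simp only [← he, ← hy, ← hz, List.nodup_cons, List.nodup_append, List.mem_cons,
    List.mem_append, not_or] at hd
  obtain ⟨S, hS, hoS, hcS, hlS, hTS⟩ := iha (T.next e) (by tauto)
  obtain ⟨R, hR, hoR, hcR, hlR, hTR⟩ := ihb (T.next z) (by tauto)
  obtain ⟨P, hP, hoP, hcP, hlP, hTP⟩ := ihc (T.next (T.next z)) (by tauto)
  clear iha ihb ihc
  have ny : T.next y = e := by rw [hy, T.next_next_next]
  have oz : T.opp z = y := by rw [hz, T.opp_opp]
  have hi : ∀ x, x ∈ T.inner d (.node a (.node b c)) ↔ x = e ∨ x = T.next e ∨ x = y ∨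
      x ∈ T.inner (T.next e) a ∨ x = z ∨ x = T.next z ∨ x = T.next (T.next z) ∨
      x ∈ T.inner (T.next z) b ∨ x ∈ T.inner (T.next (T.next z)) c := by
    intro x
    simp only [inner, ← he, ← hy, ← hz, List.mem_cons, List.mem_append]
  refine ⟨{x | x = y ∨ x = z ∨ x ∈ S ∨ x ∈ R ∨ x ∈ P}, ?_, ?_, ?_, ?_, ?_⟩
  · intro x hx
    rw [hi]
    simp only [Set.mem_ofPred_eq] at hx
    grind
  · simp only [Set.mem_ofPred_eq, ← he]
    grind
  · rintro x (rfl | rfl | hx | hx | hx)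
    · simp only [Set.mem_ofPred_eq, ny]
      grind
    · simp only [Set.mem_ofPred_eq, oz]
      grind
    · have e1 := T.next_mem_inner (hS x hx)
      have e2 := T.next_mem_inner e1
      have := hcS x hx
      simp only [Set.mem_ofPred_eq]
      grind
    · have e1 := T.next_mem_inner (hR x hx)
      have e2 := T.next_mem_inner e1
      have := hcR x hx
      simp only [Set.mem_ofPred_eq]
      grind
    · have e1 := T.next_mem_inner (hP x hx)
      have e2 := T.next_mem_inner e1
      have := hcP x hx
      simp only [Set.mem_ofPred_eq]
      grind
  · intro x hx
    right
    simp only [leafDarts, ← he, ← hy, ← hz, List.mem_append] at hx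
    simp only [Set.mem_ofPred_eq]
    rcases hx with hx | hx | hx
    · have := T.mem_inner_of_mem_leafDarts hx
      have := hlS x hx
      grind
    · have := T.mem_inner_of_mem_leafDarts hx
      have := hlR x hx
      grind
    · have := T.mem_inner_of_mem_leafDarts hx
      have := hlP x hx
      grind
  · intro T' Q hQ hQS
    have hQ' := hQ
    obtain ⟨-, -, ho, hm, -, -, -⟩ := hQ
    simp only [hi, Set.mem_ofPred_eq] at hQS
    obtain ⟨p1, q1⟩ := hTS T' Q hQ' (by grind)
    obtain ⟨p2, q2⟩ := hTR T' Q hQ' (by grind)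
    obtain ⟨p3, q3⟩ := hTP T' Q hQ' (by grind)
    have my := hm y (by grind)
    have mz := hm z (by grind)
    simp only [ny, oz, ← hz] at my mz
    obtain ⟨m1, m2, m3⟩ := my
    obtain ⟨-, m5, -⟩ := mz
    -- The new triangles are `(e, y, next (next z))` and `(z, next e, next z)`, with `next` taken in
    -- `T`: crossing `y` now leads to the subtrees `a'` and `b'`, and `c'` hangs off the first
    -- triangle.
    simp only [inner, leafDarts, ho, ← he, ← hz, ← hy, m1, m2, m3, m5, q1, q2, q3,
      List.append_assoc, and_true]
    classical
    rw [List.perm_iff_count] at p1 p2 p3 ⊢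
    intro x
    have := p1 x
    have := p2 x
    have := p3 x
    simp only [List.count_cons, List.count_append]
    omega

-- The reflected case: the flipped side has the darts `x₀` and `z`, and `x₀` precedes the third side
-- `y` of the first triangle.
set_option maxHeartbeats 1000000 in
theorem realizes_right (T : Triangulation n D) {a a' b b' c c' : BinTree α} (d : D)
    (iha : ∀ d, (T.inner d a).Nodup → T.Realizes d a a')
    (ihb : ∀ d, (T.inner d b).Nodup → T.Realizes d b b')
    (ihc : ∀ d, (T.inner d c).Nodup → T.Realizes d c c')
    (hd : (T.inner d (.node (.node a b) c)).Nodup) :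
    T.Realizes d (.node (.node a b) c) (.node a' (.node b' c')) := by
  simp only [inner] at hd
  obtain ⟨e, he⟩ : ∃ e, e = T.opp d := ⟨_, rfl⟩
  obtain ⟨x₀, hx₀⟩ : ∃ x, x = T.next e := ⟨_, rfl⟩
  obtain ⟨y, hy⟩ : ∃ y, y = T.next x₀ := ⟨_, rfl⟩
  obtain ⟨z, hz⟩ : ∃ z, z = T.opp x₀ := ⟨_, rfl⟩
  simp only [← he, ← hx₀, ← hy, ← hz, List.nodup_cons, List.nodup_append, List.mem_cons,
    List.mem_append, not_or] at hd
  obtain ⟨S, hS, hoS, hcS, hlS, hTS⟩ := iha (T.next z) (by tauto)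
  obtain ⟨R, hR, hoR, hcR, hlR, hTR⟩ := ihb (T.next (T.next z)) (by tauto)
  obtain ⟨P, hP, hoP, hcP, hlP, hTP⟩ := ihc y (by tauto)
  clear iha ihb ihc
  have ny : T.next y = e := by rw [hy, hx₀, T.next_next_next]
  have oz : T.opp z = x₀ := by rw [hz, T.opp_opp]
  have hi : ∀ x, x ∈ T.inner d (.node (.node a b) c) ↔ x = e ∨ x = x₀ ∨ x = y ∨
      x = z ∨ x = T.next z ∨ x = T.next (T.next z) ∨
      x ∈ T.inner (T.next z) a ∨ x ∈ T.inner (T.next (T.next z)) b ∨ x ∈ T.inner y c := by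
    intro x
    simp only [inner, ← he, ← hx₀, ← hy, ← hz, List.mem_cons, List.mem_append, or_assoc]
  refine ⟨{x | x = x₀ ∨ x = z ∨ x ∈ S ∨ x ∈ R ∨ x ∈ P}, ?_, ?_, ?_, ?_, ?_⟩
  · intro x hx
    rw [hi]
    simp only [Set.mem_ofPred_eq] at hx
    grind
  · simp only [Set.mem_ofPred_eq, ← he]
    grind
  · rintro x (rfl | rfl | hx | hx | hx)
    · simp only [Set.mem_ofPred_eq, ← hy, ny]
      grind
    · simp only [Set.mem_ofPred_eq, oz]
      grind
    · have e1 := T.next_mem_inner (hS x hx)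
      have e2 := T.next_mem_inner e1
      have := hcS x hx
      simp only [Set.mem_ofPred_eq]
      grind
    · have e1 := T.next_mem_inner (hR x hx)
      have e2 := T.next_mem_inner e1
      have := hcR x hx
      simp only [Set.mem_ofPred_eq]
      grind
    · have e1 := T.next_mem_inner (hP x hx)
      have e2 := T.next_mem_inner e1
      have := hcP x hx
      simp only [Set.mem_ofPred_eq]
      grind
  · intro x hx
    right
    simp only [leafDarts, ← he, ← hx₀, ← hy, ← hz, List.mem_append, or_assoc] at hx
    simp only [Set.mem_ofPred_eq]
    rcases hx with hx | hx | hx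
    · have := T.mem_inner_of_mem_leafDarts hx
      have := hlS x hx
      grind
    · have := T.mem_inner_of_mem_leafDarts hx
      have := hlR x hx
      grind
    · have := T.mem_inner_of_mem_leafDarts hx
      have := hlP x hx
      grind
  · intro T' Q hQ hQS
    have hQ' := hQ
    obtain ⟨-, -, ho, hm, -, -, -⟩ := hQ
    simp only [hi, Set.mem_ofPred_eq] at hQS
    obtain ⟨p1, q1⟩ := hTS T' Q hQ' (by grind)
    obtain ⟨p2, q2⟩ := hTR T' Q hQ' (by grind)
    obtain ⟨p3, q3⟩ := hTP T' Q hQ' (by grind)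
    have my := hm x₀ (by grind)
    have mz := hm z (by grind)
    simp only [ny, oz, ← hz, ← hy] at my mz
    obtain ⟨-, m2, m3⟩ := my
    obtain ⟨m4, -, m6⟩ := mz
    simp only [inner, leafDarts, ho, ← he, ← hz, ← hx₀, ← hy, oz, m2, m3, m4, m6, q1, q2,
      q3, List.append_assoc, and_true]
    classical
    rw [List.perm_iff_count] at p1 p2 p3 ⊢
    intro x
    have := p1 x
    have := p2 x
    have := p3 x
    simp only [List.count_cons, List.count_append]
    omega

theorem realizes (T : Triangulation n D) {t t' : BinTree α} (h : t.SimRot t') (d : D)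
    (hd : (T.inner d t).Nodup) : T.Realizes d t t' := by
  induction h generalizing d with
  | leaf a => exact ⟨∅, by simp, by simp, by simp, by simp, by simp [inner, leafDarts]⟩
  | node _ _ iha ihb => exact T.realizes_node d iha ihb hd
  | left _ _ _ iha ihb ihc => exact T.realizes_left d iha ihb ihc hd
  | right _ _ _ iha ihb ihc => exact T.realizes_right d iha ihb ihc hd

end Triangulation

/-! ### A polygon with glued sides determines the triangulation -/

namespace Triangulation

variable {n : ℕ} {D E α : Type}

/-- Cutting the disk along the arcs at the leaves of the tree `t` yields a polygon, whose
triangulation has shape `t`: the development behind the boundary curve meets every triangle exactly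
once. -/
structure Develops (T : Triangulation n D) (t : BinTree α) : Prop where
  nodup : (T.root :: T.inner T.root t).Nodup
  mem : ∀ d, d ∈ T.root :: T.inner T.root t

theorem Develops.of_perm {T : Triangulation n D} {t t' : BinTree α} (h : T.Develops t)
    (hp : (T.inner T.root t').Perm (T.inner T.root t)) : T.Develops t' :=
  ⟨(hp.cons T.root).nodup_iff.2 h.nodup, fun d => (hp.cons T.root).mem_iff.2 (h.mem d)⟩

/-- Only diagonals of the polygon are flipped. Its sides remain, with their order, gluing and
labels, which is what permits iteration. -/
theorem Develops.exists_flipAlong [Finite D] {T : Triangulation n D} {t t' : BinTree α}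
    (hT : T.Develops t) (h : t.SimRot t') : ∃ (S : Set D) (T' : Triangulation n D),
      FlipAlong S T T' ∧ T'.Develops t' ∧ T'.opp = T.opp ∧
      T'.leafDarts T'.root t' = T.leafDarts T.root t ∧
      ∀ x ∈ T.leafDarts T.root t, T'.vert x = T.vert x := by
  have hnd := List.nodup_cons.1 hT.nodup
  obtain ⟨S, hS, -, hcS, hlS, hTS⟩ := T.realizes h T.root hnd.2
  have hr : T.root ∉ S := fun e => hnd.1 (hS _ e)
  have hF : T.Flippable S := ⟨hr, fun d hd => (hcS d hd).1, fun d hd => (hcS d hd).2.1,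
    fun d hd => (hcS d hd).2.2⟩
  have hA := T.flipAlong_flip hF
  obtain ⟨h1, h2⟩ := hTS _ S hA fun _ _ => Iff.rfl
  refine ⟨S, T.flip hF, hA, ⟨?_, fun d => ?_⟩, rfl, h2, fun x hx => ?_⟩
  · exact (h1.cons T.root).nodup_iff.2 hT.nodup
  · exact (h1.cons T.root).mem_iff.2 (hT.mem d)
  · refine flipVert_of_notMem ?_
    rcases hlS x hx with rfl | h
    · exact hr
    · exact h

/-- Corresponding darts in two developments of the same shape. -/
def innerPairs (T : Triangulation n D) (T' : Triangulation n E) :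
    D → E → BinTree α → List (D × E)
  | _, _, .leaf _ => []
  | d, d', .node l r => (T.opp d, T'.opp d') :: (T.next (T.opp d), T'.next (T'.opp d')) ::
      (T.next (T.next (T.opp d)), T'.next (T'.next (T'.opp d'))) ::
      (T.innerPairs T' (T.next (T.opp d)) (T'.next (T'.opp d')) l ++
        T.innerPairs T' (T.next (T.next (T.opp d))) (T'.next (T'.next (T'.opp d'))) r)

/-- Corresponding darts at the leaves of two developments of the same shape. -/
def leafPairs (T : Triangulation n D) (T' : Triangulation n E) :
    D → E → BinTree α → List (D × E)
  | d, d', .leaf _ => [(d, d')]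
  | d, d', .node l r =>
      T.leafPairs T' (T.next (T.opp d)) (T'.next (T'.opp d')) l ++
        T.leafPairs T' (T.next (T.next (T.opp d))) (T'.next (T'.next (T'.opp d'))) r

variable (T : Triangulation n D) (T' : Triangulation n E)

theorem map_fst_innerPairs (d : D) (d' : E) (t : BinTree α) :
    (T.innerPairs T' d d' t).map Prod.fst = T.inner d t := by
  induction t generalizing d d' with
  | leaf a => rfl
  | node l r hl hr => simp [innerPairs, inner, hl, hr]

theorem map_snd_innerPairs (d : D) (d' : E) (t : BinTree α) :
    (T.innerPairs T' d d' t).map Prod.snd = T'.inner d' t := by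
  induction t generalizing d d' with
  | leaf a => rfl
  | node l r hl hr => simp [innerPairs, inner, hl, hr]

theorem leafPairs_eq_zip (d : D) (d' : E) (t : BinTree α) :
    T.leafPairs T' d d' t = (T.leafDarts d t).zip (T'.leafDarts d' t) := by
  have h1 : (T.leafPairs T' d d' t).map Prod.fst = T.leafDarts d t := by
    induction t generalizing d d' with
    | leaf a => rfl
    | node l r hl hr => simp [leafPairs, leafDarts, hl, hr]
  have h2 : (T.leafPairs T' d d' t).map Prod.snd = T'.leafDarts d' t := by
    clear h1
    induction t generalizing d d' with
    | leaf a => rfl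
    | node l r hl hr => simp [leafPairs, leafDarts, hl, hr]
  rw [← h1, ← h2, List.zip_map']
  simp

variable {T T'}

theorem next_mem_innerPairs {d : D} {d' : E} {t : BinTree α} {p : D × E}
    (h : p ∈ T.innerPairs T' d d' t) : (T.next p.1, T'.next p.2) ∈ T.innerPairs T' d d' t := by
  induction t generalizing d d' with
  | leaf a => simp [innerPairs] at h
  | node l r hl hr =>
    simp only [innerPairs, List.mem_cons, List.mem_append] at h ⊢
    rcases h with rfl | rfl | rfl | h | h
    · simp
    · simp
    · simp [T.next_next_next, T'.next_next_next]
    · exact Or.inr (Or.inr (Or.inr (Or.inl (hl h))))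
    · exact Or.inr (Or.inr (Or.inr (Or.inr (hr h))))

theorem opp_mem_innerPairs {d : D} {d' : E} {t : BinTree α} {p : D × E}
    (h : p ∈ (d, d') :: T.innerPairs T' d d' t) :
    (T.opp p.1, T'.opp p.2) ∈ (d, d') :: T.innerPairs T' d d' t ∨ p ∈ T.leafPairs T' d d' t := by
  induction t generalizing d d' with
  | leaf a => exact Or.inr (by simpa [innerPairs, leafPairs] using h)
  | node l r hl hr =>
    simp only [innerPairs, leafPairs, List.mem_cons, List.mem_append] at h hl hr ⊢
    rcases h with rfl | rfl | h | h | h | h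
    · simp
    · simp [T.opp_opp, T'.opp_opp]
    · rcases hl (Or.inl h) with (h | h) | h <;> simp only [h, true_or, or_true]
    · rcases hr (Or.inl h) with (h | h) | h <;> simp only [h, true_or, or_true]
    · rcases hl (Or.inr h) with (h | h) | h <;> simp only [h, true_or, or_true]
    · rcases hr (Or.inr h) with (h | h) | h <;> simp only [h, true_or, or_true]

theorem mem_innerPairs_of_mem_leafPairs {d : D} {d' : E} {t : BinTree α} {p : D × E}
    (h : p ∈ T.leafPairs T' d d' t) : p ∈ (d, d') :: T.innerPairs T' d d' t := by
  induction t generalizing d d' with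
  | leaf a => simpa [leafPairs] using Or.inl h
  | node l r hl hr =>
    simp only [innerPairs, leafPairs, List.mem_cons, List.mem_append] at h hl hr ⊢
    rcases h with h | h
    · rcases hl h with h | h <;> simp only [h, true_or, or_true]
    · rcases hr h with h | h <;> simp only [h, true_or, or_true]

/-- Every corner of the polygon is an endpoint of one of its sides; the endpoints of a diagonal are
found from the two other sides of the triangle behind it. -/
theorem vert_eq_of_mem_innerPairs {d : D} {d' : E} {t : BinTree α}
    (hl : ∀ p ∈ T.leafPairs T' d d' t, T'.vert p.2 = T.vert p.1 ∧
      T'.vert (T'.opp p.2) = T.vert (T.opp p.1)) {p : D × E}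
    (h : p ∈ (d, d') :: T.innerPairs T' d d' t) : T'.vert p.2 = T.vert p.1 ∧
      T'.vert (T'.opp p.2) = T.vert (T.opp p.1) := by
  induction t generalizing d d' p with
  | leaf a => exact hl p (by simpa [innerPairs, leafPairs] using h)
  | node l r h1 h2 =>
    simp only [leafPairs, List.mem_append] at hl
    have k1 := fun p => h1 (p := p) fun p hp => hl p (Or.inl hp)
    have k2 := fun p => h2 (p := p) fun p hp => hl p (Or.inr hp)
    have l1 := (k1 _ List.mem_cons_self).1
    have l2 := (k2 _ List.mem_cons_self).2
    simp only [← vert_next, vert_next_opp, next_next_next] at l1 l2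
    rw [vert_next, vert_next] at l2
    simp only [innerPairs, List.mem_cons, List.mem_append] at h k1 k2
    rcases h with rfl | rfl | h | h | h | h
    · exact ⟨l1, l2⟩
    · simp only [opp_opp]
      exact ⟨l2, l1⟩
    · exact k1 p (Or.inl h)
    · exact k2 p (Or.inl h)
    · exact k1 p (Or.inr h)
    · exact k2 p (Or.inr h)

/-- Two triangulations are homeomorphic when they have developments of the same shape, with the same
gluing of the sides of the polygon and the same labels. -/
theorem Develops.orientedIso {t : BinTree α} (hT : T.Develops t) (hT' : T'.Develops t)
    (ho : ∀ p ∈ T.leafPairs T' T.root T'.root t,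
      (T.opp p.1, T'.opp p.2) ∈ T.leafPairs T' T.root T'.root t)
    (hv : ∀ p ∈ T.leafPairs T' T.root T'.root t, T'.vert p.2 = T.vert p.1) : OrientedIso T T' := by
  -- The list `P` is the graph of the isomorphism: each of its two projections lists every dart
  -- exactly once.
  obtain ⟨P, hP⟩ : ∃ P, P = (T.root, T'.root) :: T.innerPairs T' T.root T'.root t := ⟨_, rfl⟩
  have hf : P.map Prod.fst = T.root :: T.inner T.root t := by
    rw [hP, List.map_cons, map_fst_innerPairs]
  have hs : P.map Prod.snd = T'.root :: T'.inner T'.root t := by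
    rw [hP, List.map_cons, map_snd_innerPairs]
  have hfn := hT.nodup
  have hsn := hT'.nodup
  rw [← hf] at hfn
  rw [← hs] at hsn
  have hfi := List.inj_on_of_nodup_map hfn
  have hsi := List.inj_on_of_nodup_map hsn
  have hex : ∀ x, ∃ y, (x, y) ∈ P := fun x => by
    have := hT.mem x
    rw [← hf, List.mem_map] at this
    obtain ⟨⟨a, b⟩, hp, rfl⟩ := this
    exact ⟨b, hp⟩
  choose e he using hex
  have hu : ∀ x y, (x, y) ∈ P → y = e x := fun x y h => by
    have := hfi h (he x) rfl
    exact congrArg Prod.snd this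
  have hbij : Function.Bijective e := by
    constructor
    · intro x y hxy
      have := hsi (he x) (he y) hxy
      exact congrArg Prod.fst this
    · intro y
      have := hT'.mem y
      rw [← hs, List.mem_map] at this
      obtain ⟨⟨a, b⟩, hp, rfl⟩ := this
      exact ⟨a, (hu _ _ hp).symm⟩
  refine ⟨Equiv.ofBijective e hbij, fun d => ⟨?_, ?_, ?_⟩⟩
  · refine hu _ _ ?_
    have := he d
    rw [hP, List.mem_cons] at this ⊢
    rcases this with h | h
    · left
      rw [Prod.mk.injEq] at h
      simp only [Equiv.ofBijective_apply]
      rw [h.2, h.1, T.next_root, T'.next_root]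
    · exact Or.inr (next_mem_innerPairs h)
  · refine hu _ _ ?_
    have := he d
    rw [hP] at this ⊢
    rcases opp_mem_innerPairs this with h | h
    · exact h
    · exact mem_innerPairs_of_mem_leafPairs (ho _ h)
  · have := he d
    rw [hP] at this
    exact (vert_eq_of_mem_innerPairs (fun p hp => ⟨hv p hp, hv _ (ho p hp)⟩) this).1

end Triangulation

namespace Triangulation

variable {n : ℕ} {D α : Type}

/-! ### Existence of developments -/

/-- No arc that is crossed by a development belongs to the given set of darts. -/
def Avoids (T : Triangulation n D) (K : Set D) : D → BinTree α → Prop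
  | _, .leaf _ => True
  | d, .node l r => d ∉ K ∧ T.Avoids K (T.next (T.opp d)) l ∧
      T.Avoids K (T.next (T.next (T.opp d))) r

theorem exists_extend (T : Triangulation n D) (K : Set D) {d x : D} {t : BinTree Unit}
    (ht : T.Avoids K d t) (hx : x ∈ T.leafDarts d t) (hxK : x ∉ K) :
    ∃ t' : BinTree Unit, t'.count = t.count + 1 ∧ T.Avoids K d t' ∧ (T.inner d t').Perm
      (T.opp x :: T.next (T.opp x) :: T.next (T.next (T.opp x)) :: T.inner d t) := by
  classical
  induction t generalizing d with
  | leaf a =>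
    obtain rfl : x = d := by simpa [leafDarts] using hx
    exact ⟨.node (.leaf ()) (.leaf ()), rfl, ⟨hxK, trivial, trivial⟩, by simp [inner]⟩
  | node l r hl hr =>
    simp only [leafDarts, List.mem_append] at hx
    obtain ⟨h1, h2, h3⟩ := ht
    rcases hx with hx | hx
    · obtain ⟨t', e1, e2, e3⟩ := hl h2 hx
      refine ⟨.node t' r, by simp only [BinTree.count, e1]; omega, ⟨h1, e2, h3⟩, ?_⟩
      rw [List.perm_iff_count] at e3 ⊢
      intro a
      have := e3 a
      simp only [inner, List.count_cons, List.count_append] at this ⊢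
      omega
    · obtain ⟨t', e1, e2, e3⟩ := hr h3 hx
      refine ⟨.node l t', by simp only [BinTree.count, e1]; omega, ⟨h1, h2, e2⟩, ?_⟩
      rw [List.perm_iff_count] at e3 ⊢
      intro a
      have := e3 a
      simp only [inner, List.count_cons, List.count_append] at this ⊢
      omega

theorem length_inner (T : Triangulation n D) (d : D) (t : BinTree α) :
    (T.inner d t).length + 3 = 3 * t.count := by
  induction t generalizing d with
  | leaf a => rfl
  | node l r hl hr =>
    have h1 := hl (T.next (T.opp d))
    have h2 := hr (T.next (T.next (T.opp d)))
    simp only [inner, List.length_cons, List.length_append, BinTree.count]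
    omega

theorem length_leafDarts (T : Triangulation n D) (d : D) (t : BinTree α) :
    (T.leafDarts d t).length = t.count := by
  induction t generalizing d with
  | leaf a => rfl
  | node l r hl hr => simp [leafDarts, BinTree.count, hl, hr]

theorem opp_mem_inner (T : Triangulation n D) {d p : D} {t : BinTree α}
    (h : p ∈ d :: T.inner d t) : T.opp p ∈ d :: T.inner d t ∨ p ∈ T.leafDarts d t := by
  induction t generalizing d with
  | leaf a => exact Or.inr (by simpa [inner, leafDarts] using h)
  | node l r hl hr =>
    simp only [inner, leafDarts, List.mem_cons, List.mem_append] at h hl hr ⊢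
    rcases h with rfl | rfl | h | h | h | h
    · simp
    · simp [T.opp_opp]
    · rcases hl (Or.inl h) with (h | h) | h <;> simp only [h, true_or, or_true]
    · rcases hr (Or.inl h) with (h | h) | h <;> simp only [h, true_or, or_true]
    · rcases hl (Or.inr h) with (h | h) | h <;> simp only [h, true_or, or_true]
    · rcases hr (Or.inr h) with (h | h) | h <;> simp only [h, true_or, or_true]

theorem mem_leafDarts_of_avoids (T : Triangulation n D) {K : Set D} (hK : ∀ x ∈ K, T.opp x ∈ K)
    {d p : D} {t : BinTree α} (ht : T.Avoids K d t) (h : p ∈ d :: T.inner d t) (hp : p ∈ K) :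
    p ∈ T.leafDarts d t := by
  induction t generalizing d with
  | leaf a => simpa [inner, leafDarts] using h
  | node l r hl hr =>
    obtain ⟨h1, h2, h3⟩ := ht
    simp only [inner, leafDarts, List.mem_cons, List.mem_append] at h hl hr ⊢
    rcases h with rfl | rfl | h | h | h | h
    · exact absurd hp h1
    · have := hK _ hp
      rw [T.opp_opp] at this
      exact absurd this h1
    · exact Or.inl (hl h2 (Or.inl h))
    · exact Or.inr (hr h3 (Or.inl h))
    · exact Or.inl (hl h2 (Or.inr h))
    · exact Or.inr (hr h3 (Or.inr h))

theorem next_mem_cons_inner (T : Triangulation n D) {z : D} {t : BinTree α}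
    (h : z ∈ T.root :: T.inner T.root t) : T.next z ∈ T.root :: T.inner T.root t := by
  rcases List.mem_cons.1 h with rfl | h
  · rw [T.next_root]
    exact List.mem_cons_self
  · exact List.mem_cons_of_mem _ (T.next_mem_inner h)

/-- A set of arcs such that the disk remains connected when it is cut along them is contained in
the set of sides of a polygon. -/
theorem exists_develops [Finite D] (T : Triangulation n D) {K : Set D}
    (hK : ∀ x ∈ K, T.opp x ∈ K)
    (hC : ∀ C : Set D, T.root ∈ C → (∀ x ∈ C, T.next x ∈ C) → (∀ x ∈ C, x ∉ K → T.opp x ∈ C) →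
      ∀ x, x ∈ C) :
    ∃ t : BinTree Unit, T.Develops t ∧ ∀ x ∈ K, x ∈ T.leafDarts T.root t := by
  classical
  have := Fintype.ofFinite D
  -- Take a development that crosses no arc of `K`, repeats no dart and has as many leaves as
  -- possible.
  let N : Set ℕ := {k | ∃ t : BinTree Unit, (T.root :: T.inner T.root t).Nodup ∧
    T.Avoids K T.root t ∧ t.count = k}
  have hN : N.Nonempty := ⟨1, .leaf (), by simp [inner], trivial, rfl⟩
  have hb : BddAbove N := by
    refine ⟨Fintype.card D + 3, ?_⟩
    rintro k ⟨t, h1, -, rfl⟩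
    have h2 := h1.length_le_card
    have h3 := T.length_inner T.root t
    rw [List.length_cons] at h2
    omega
  obtain ⟨t, h1, h2, h3⟩ := Nat.sSup_mem hN hb
  -- By maximality, the triangle behind a side outside `K` has already been met. Hence the darts of
  -- the development satisfy the closure conditions in `hC`.
  have hleaf : ∀ x ∈ T.leafDarts T.root t, x ∉ K → T.opp x ∈ T.root :: T.inner T.root t := by
    intro x hx hxK
    by_contra ho
    obtain ⟨t', e1, e2, e3⟩ := T.exists_extend K h2 hx hxK
    have h4 : t.count + 1 ≤ t.count := by
      conv_rhs => rw [h3]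
      refine le_csSup hb ⟨t', ?_, e2, e1⟩
      have e4 := e3.cons T.root
      rw [e4.nodup_iff]
      have hr : T.opp x ≠ T.root := fun e => ho (by rw [e]; exact List.mem_cons_self)
      have n1 := T.next_ne _ hr
      -- The darts met so far form whole faces, so if one dart of the triangle is new then all three
      -- are.
      have o1 : T.next (T.opp x) ∉ T.root :: T.inner T.root t := fun e => ho (by
        have := T.next_mem_cons_inner (T.next_mem_cons_inner e)
        rwa [T.next_next_next] at this)
      have o2 : T.next (T.next (T.opp x)) ∉ T.root :: T.inner T.root t := fun e => ho (by
        have := T.next_mem_cons_inner e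
        rwa [T.next_next_next] at this)
      have n2 : T.next (T.next (T.opp x)) ≠ T.next (T.opp x) := fun e => n1 (T.next.injective e)
      have n3 : T.next (T.next (T.opp x)) ≠ T.opp x := fun e => n1 (by
        have := T.next_next_next (T.opp x)
        rwa [e] at this)
      simp only [List.mem_cons, not_or] at ho o1 o2
      simp only [List.nodup_cons] at h1 ⊢
      simp only [List.mem_cons, not_or]
      exact ⟨⟨Ne.symm ho.1, Ne.symm o1.1, Ne.symm o2.1, h1.1⟩, ⟨n1.symm, n3.symm, ho.2⟩,
        ⟨n2.symm, o1.2⟩, o2.2, h1.2⟩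
    omega
  have hall := hC {x | x ∈ T.root :: T.inner T.root t} List.mem_cons_self
    (fun x hx => T.next_mem_cons_inner hx) (fun x hx hxK => by
      rcases T.opp_mem_inner hx with h | h
      · exact h
      · exact hleaf x h hxK)
  exact ⟨t, ⟨h1, hall⟩, fun x hx => T.mem_leafDarts_of_avoids hK h2 (hall x) hx⟩

theorem forall_mem_of_closed (T : Triangulation n D) (C : Set D) (hr : T.root ∈ C)
    (hn : ∀ x ∈ C, T.next x ∈ C) (ho : ∀ x ∈ C, T.opp x ∈ C) (x : D) : x ∈ C := by
  obtain ⟨g, hg, rfl⟩ := T.connected T.root x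
  have : ∀ y, y ∈ C ↔ g y ∈ C := by
    induction hg using Subgroup.closure_induction with
    | mem f hf =>
      rcases hf with rfl | rfl
      · exact fun y => ⟨hn y, fun h => by
          have := hn _ (hn _ h)
          rwa [T.next_next_next] at this⟩
      · exact fun y => ⟨ho y, fun h => by
          have := ho _ h
          rwa [T.opp_opp] at this⟩
    | one => exact fun y => Iff.rfl
    | mul f g _ _ hf hg => exact fun y => (hg y).trans (hf (g y))
    | inv f _ hf =>
      intro y
      have := hf (f⁻¹ y)
      rw [self_inv_apply] at this
      exact this.symm
  exact (this _).1 hr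

/-- Every triangulation can be cut into a polygon. -/
theorem exists_develops_of_finite [Finite D] (T : Triangulation n D) :
    ∃ t : BinTree Unit, T.Develops t := by
  obtain ⟨t, ht, -⟩ := T.exists_develops (K := ∅) (by simp) fun C h1 h2 h3 =>
    T.forall_mem_of_closed C h1 h2 fun x hx => h3 x hx (Set.notMem_empty x)
  exact ⟨t, ht⟩

/-- The root and `t.count - 1` triangles account for all `6 * n - 2` darts. -/
theorem Develops.count_eq [Finite D] {T : Triangulation n D} {t : BinTree α} (h : T.Develops t) :
    t.count = 2 * n := by
  classical
  have := Fintype.ofFinite D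
  have h1 := T.card_darts
  rw [Nat.card_eq_fintype_card] at h1
  have h2 : (T.root :: T.inner T.root t).length = Fintype.card D := by
    rw [← List.toFinset_card_of_nodup h.nodup, ← Finset.card_univ]
    congr 1
    ext x
    simpa using h.mem x
  have h3 := T.length_inner T.root t
  rw [List.length_cons] at h2
  omega

/-! ### Stars -/

/-- In a fan, every marked point is adjacent to the apex. -/
theorem vert_adjacent_of_spine (T : Triangulation n D) (d : D) (hd : T.vert d = none)
    (a : α) (L : List α) :
    ∀ p ∈ T.inner d (BinTree.spine (.leaf a) L), T.vert p = none ∨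
      ∃ e, T.vert e = none ∧ T.vert (T.opp e) = T.vert p := by
  induction L using List.reverseRecOn generalizing d with
  | nil => simp [BinTree.spine, inner]
  | append_singleton L b ih =>
    intro p hp
    rw [BinTree.spine, List.foldl_append, List.foldl_cons, List.foldl_nil,
      ← BinTree.spine] at hp
    simp only [inner, List.append_nil, List.mem_cons] at hp
    -- The left child starts at the same point as `d`, so all triangles along the branch share the
    -- apex.
    have hx : T.vert (T.next (T.opp d)) = none := by rw [T.vert_next_opp, hd]
    rcases hp with rfl | rfl | rfl | hp
    · exact Or.inr ⟨d, hd, rfl⟩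
    · exact Or.inl hx
    · exact Or.inr ⟨_, hx, (T.vert_next _).symm⟩
    · exact ih _ hx p hp

/-- The endpoints of the darts in a list form a path. -/
def IsPath (T : Triangulation n D) : Option (Fin n) → List D → Option (Fin n) → Prop
  | u, [], w => u = w
  | u, x :: L, w => T.vert x = u ∧ T.IsPath (T.vert (T.opp x)) L w

theorem IsPath.append {T : Triangulation n D} {u v w : Option (Fin n)} {L L' : List D}
    (h : T.IsPath u L v) (h' : T.IsPath v L' w) : T.IsPath u (L ++ L') w := by
  induction L generalizing u with
  | nil => rw [show u = v from h]; exact h'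
  | cons x L ih => exact ⟨h.1, ih h.2⟩

theorem isPath_leafDarts (T : Triangulation n D) (d : D) (t : BinTree α) :
    T.IsPath (T.vert d) (T.leafDarts d t) (T.vert (T.opp d)) := by
  induction t generalizing d with
  | leaf a => exact ⟨rfl, rfl⟩
  | node l r hl hr =>
    have h1 := hl (T.next (T.opp d))
    have h2 := hr (T.next (T.next (T.opp d)))
    rw [← T.vert_next (T.next (T.opp d)), T.vert_next_opp] at h1
    rw [← T.vert_next (T.next (T.next (T.opp d))), T.next_next_next] at h2
    exact h1.append h2

/-- The sides of the polygon that arises by cutting the disk along some arcs that start at the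
same point, the last arc coming first in the list. -/
def star (T : Triangulation n D) : List D → List D
  | [] => []
  | x :: L => T.star L ++ [x, T.opp x]

theorem star_append (T : Triangulation n D) (L L' : List D) :
    T.star (L ++ L') = T.star L' ++ T.star L := by
  induction L with
  | nil => simp [star]
  | cons x L ih => simp [star, ih]

theorem length_star (T : Triangulation n D) (L : List D) : (T.star L).length = 2 * L.length := by
  induction L with
  | nil => rfl
  | cons x L ih => simp [star, ih]; ring

theorem mem_star (T : Triangulation n D) {L : List D} {x : D} (h : x ∈ T.star L) :
    x ∈ L ∨ T.opp x ∈ L := by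
  induction L with
  | nil => simp [star] at h
  | cons y L ih =>
    simp only [star, List.mem_append, List.mem_cons, List.not_mem_nil, or_false] at h ⊢
    rcases h with h | rfl | rfl
    · exact (ih h).imp Or.inr Or.inr
    · simp
    · simp [T.opp_opp]

/-- `T` is cut into a polygon of shape `t` by arcs from the boundary marked point to the points in
the list `r`, the last arc coming first in the list. -/
def IsStar (T : Triangulation n D) (t : BinTree α) (r : List (Fin n)) : Prop :=
  T.Develops t ∧ ∃ L : List D, T.leafDarts T.root t = T.star L ∧ (∀ x ∈ L, T.vert x = none) ∧
    L.map (fun x => T.vert (T.opp x)) = r.map some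

/-- After `e w` the path is at the point `w`, and the only available side that starts there is
`T.opp (e w)`; so the sides come in adjacent pairs. The bound `k` serves the induction, which
removes two sides at a time. -/
theorem star_of_isPath (T : Triangulation n D) (e : Fin n → D)
    (he : ∀ w, T.vert (e w) = none ∧ T.vert (T.opp (e w)) = some w) (k : ℕ) (L : List D)
    (hk : L.length ≤ k) (hL : ∀ x ∈ L, ∃ w, x = e w ∨ x = T.opp (e w))
    (hp : T.IsPath none L none) : ∃ r : List (Fin n), L = T.star (r.map e) := by
  induction k generalizing L with
  | zero =>
    obtain rfl : L = [] := List.length_eq_zero_iff.1 (by omega)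
    exact ⟨[], rfl⟩
  | succ k ih =>
    rcases L with _ | ⟨x, L⟩
    · exact ⟨[], rfl⟩
    obtain ⟨w, rfl | rfl⟩ := hL x (by simp)
    · obtain ⟨-, hp⟩ := hp
      rw [(he w).2] at hp
      rcases L with _ | ⟨y, L⟩
      · cases hp
      obtain ⟨hy, hp⟩ := hp
      obtain ⟨w', rfl | rfl⟩ := hL y (by simp)
      · rw [(he w').1] at hy; cases hy
      · rw [(he w').2] at hy
        cases hy
        rw [T.opp_opp, (he w).1] at hp
        obtain ⟨r, rfl⟩ := ih L (by simp at hk; omega) (fun x hx => hL x (by simp [hx])) hp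
        exact ⟨r ++ [w], by simp [star_append, star]⟩
    · rw [IsPath, (he w).2] at hp
      cases hp.1

/-- The cut arc at `w` does not separate: only one cut arc ends at `w`, so one gets from one side of
it to the other by turning about `w`. Such a turn starts just past the arc and crosses no other cut
arc before it returns, since the darts `e w'` start at the boundary marked point and the darts
`T.opp (e w')` at `w'`. -/
theorem mem_iff_opp_mem_of_star [Finite D] (T : Triangulation n D) (e : Fin n → D)
    (he : ∀ w, T.vert (e w) = none ∧ T.vert (T.opp (e w)) = some w) (C : Set D)
    (h2 : ∀ x ∈ C, T.next x ∈ C)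
    (h3 : ∀ x, (∀ w, x ≠ e w ∧ x ≠ T.opp (e w)) → (T.opp x ∈ C ↔ x ∈ C)) (w : Fin n) :
    T.opp (e w) ∈ C ↔ e w ∈ C := by
  have hn : ∀ x, T.next x ∈ C ↔ x ∈ C := fun x => ⟨fun h => by
    have := h2 _ (h2 _ h)
    rwa [T.next_next_next] at this, h2 x⟩
  by_contra hne
  obtain ⟨f, hf⟩ : ∃ f, f = T.opp (e w) := ⟨_, rfl⟩
  have hv : ∀ j : ℕ, T.vert (((T.next * T.opp) ^ j) f) = some w := by
    intro j
    rw [← (he w).2, ← hf]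
    exact ((T.vert_eq_iff _ _).2 ⟨j, by simp⟩).symm
  have key : ∀ j : ℕ, ((T.next * T.opp) ^ (j + 1)) f ∈ C ↔ T.next (T.opp f) ∈ C := by
    intro j
    induction j with
    | zero => simp
    | succ j ih =>
      rw [← ih, pow_succ', Perm.mul_apply, Perm.mul_apply, hn]
      refine h3 _ fun w' => ⟨fun e1 => ?_, fun e1 => ?_⟩
      · have := hv (j + 1)
        rw [e1, (he w').1] at this
        cases this
      · have := hv (j + 1)
        rw [e1, (he w').2] at this
        cases this
        rw [e1, ← hf, hn, hf, T.opp_opp] at ih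
        exact hne ih
  have hpos := orderOf_pos (T.next * T.opp)
  have := key (orderOf (T.next * T.opp) - 1)
  rw [Nat.sub_add_cancel hpos, pow_orderOf_eq_one, Perm.one_apply, hn, hf, T.opp_opp] at this
  exact hne this

/-- If every marked point is adjacent to the boundary marked point, then the disk can be cut into a
polygon along arcs from the boundary marked point to the other marked points. -/
theorem exists_isStar [Finite D] (T : Triangulation n D)
    (h : ∀ p, T.vert p = none ∨ ∃ e, T.vert e = none ∧ T.vert (T.opp e) = T.vert p) :
    ∃ (t : BinTree Unit) (r : List (Fin n)), T.IsStar t r ∧ r.Perm (List.finRange n) := by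
  classical
  have hex : ∀ w : Fin n, ∃ e, T.vert e = none ∧ T.vert (T.opp e) = some w := fun w => by
    obtain ⟨p, hp⟩ := T.vert_surjective (some w)
    rcases h p with h | h
    · rw [hp] at h; cases h
    · rwa [hp] at h
  choose e he using hex
  obtain ⟨t, ht, hK⟩ := T.exists_develops (K := {x | ∃ w, x = e w ∨ x = T.opp (e w)}) (by
      rintro x ⟨w, rfl | rfl⟩
      · exact ⟨w, Or.inr rfl⟩
      · exact ⟨w, Or.inl (T.opp_opp _)⟩) (fun C h1 h2 h3 => by
      have h4 : ∀ x, (∀ w, x ≠ e w ∧ x ≠ T.opp (e w)) → (T.opp x ∈ C ↔ x ∈ C) := by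
        intro x hx
        constructor
        · intro hc
          have := h3 _ hc (by
            rintro ⟨w, h | h⟩
            · exact (hx w).2 (by rw [← h, T.opp_opp])
            · exact (hx w).1 (T.opp.injective h))
          rwa [T.opp_opp] at this
        · intro hc
          refine h3 x hc ?_
          rintro ⟨w, h | h⟩
          · exact (hx w).1 h
          · exact (hx w).2 h
      have h5 := T.mem_iff_opp_mem_of_star e he C h2 h4
      refine T.forall_mem_of_closed C h1 h2 fun x hx => ?_
      by_cases hxK : ∀ w, x ≠ e w ∧ x ≠ T.opp (e w)
      · exact (h4 x hxK).2 hx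
      · push Not at hxK
        obtain ⟨w, hw⟩ := hxK
        by_cases hxe : x = e w
        · rw [hxe] at hx ⊢
          exact (h5 w).2 hx
        · rw [hw hxe] at hx ⊢
          rw [T.opp_opp]
          exact (h5 w).1 hx)
  have hcount := ht.count_eq
  -- The cut arcs have `2 * n` darts, all of them sides of the polygon, which has just `2 * n` sides
  -- apart from the root; so there are no other sides.
  have heq : (Finset.univ.image e ∪ Finset.univ.image fun w => T.opp (e w)) =
      (T.leafDarts T.root t).toFinset := by
    have i1 : Function.Injective fun w => T.opp (e w) := fun a b hab => by
      have h1 := (he a).2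
      rw [show T.opp (e a) = T.opp (e b) from hab, (he b).2] at h1
      exact (Option.some.inj h1).symm
    have i2 : Function.Injective e := fun a b hab => i1 (by simp only [hab])
    refine Finset.eq_of_subset_of_card_le ?_ ?_
    · intro x hx
      simp only [Finset.mem_union, Finset.mem_image, Finset.mem_univ, true_and] at hx
      rw [List.mem_toFinset]
      rcases hx with ⟨w, rfl⟩ | ⟨w, rfl⟩
      · exact hK _ ⟨w, Or.inl rfl⟩
      · exact hK _ ⟨w, Or.inr rfl⟩
    · refine (List.toFinset_card_le _).trans ?_
      rw [length_leafDarts, hcount, Finset.card_union_of_disjoint, Finset.card_image_of_injective _ i1,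
        Finset.card_image_of_injective _ i2, Finset.card_univ, Fintype.card_fin]
      · omega
      · rw [Finset.disjoint_left]
        intro x hx hx'
        simp only [Finset.mem_image, Finset.mem_univ, true_and] at hx hx'
        obtain ⟨w, rfl⟩ := hx
        obtain ⟨w', hw'⟩ := hx'
        have := (he w').2
        rw [hw', (he w).1] at this
        cases this
  have hpath := T.isPath_leafDarts T.root t
  rw [← T.vert_next, T.next_root, T.vert_root] at hpath
  obtain ⟨r, hr⟩ := T.star_of_isPath e he _ _ le_rfl (fun x hx => by
    have : x ∈ (T.leafDarts T.root t).toFinset := List.mem_toFinset.2 hx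
    rw [← heq] at this
    simp only [Finset.mem_union, Finset.mem_image, Finset.mem_univ, true_and] at this
    rcases this with ⟨w, rfl⟩ | ⟨w, rfl⟩
    · exact ⟨w, Or.inl rfl⟩
    · exact ⟨w, Or.inr rfl⟩) hpath
  refine ⟨t, r, ⟨ht, r.map e, hr, ?_, ?_⟩, ?_⟩
  · intro x hx
    obtain ⟨w, -, rfl⟩ := List.mem_map.1 hx
    exact (he w).1
  · rw [List.map_map]
    exact List.map_congr_left fun w _ => (he w).2
  · have hlen : r.length = n := by
      have := congrArg List.length hr
      rw [length_leafDarts, hcount, length_star, List.length_map] at this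
      omega
    have hsurj : ∀ w, w ∈ r := by
      intro w
      have := hK (e w) ⟨w, Or.inl rfl⟩
      rw [hr] at this
      rcases T.mem_star this with h | h
      · obtain ⟨w', hw', h⟩ := List.mem_map.1 h
        have h1 := (he w').2
        rw [h, (he w).2] at h1
        cases h1
        exact hw'
      · obtain ⟨w', hw', h⟩ := List.mem_map.1 h
        have h1 := (he w').1
        rw [h, (he w).2] at h1
        cases h1
    have hsub : (List.finRange n).Subperm r :=
      (List.nodup_finRange n).subperm fun w _ => hsurj w
    exact (hsub.perm_of_length_le (by simp [hlen])).symm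

end Triangulation

/-! ### Stars with equal shape and order -/

namespace Triangulation

variable {n : ℕ} {D E α : Type}

theorem mem_star_of_mem (T : Triangulation n D) {L : List D} {x : D} (h : x ∈ L) :
    x ∈ T.star L ∧ T.opp x ∈ T.star L := by
  induction L with
  | nil => simp at h
  | cons y L ih =>
    simp only [star, List.mem_append, List.mem_cons, List.not_mem_nil, or_false] at h ⊢
    rcases h with rfl | h
    · simp
    · exact ⟨Or.inl (ih h).1, Or.inl (ih h).2⟩

theorem mem_zip_star (T : Triangulation n D) (T' : Triangulation n E) {L : List D} {L' : List E}
    (h : L.length = L'.length) (p : D × E) : p ∈ (T.star L).zip (T'.star L') ↔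
      p ∈ L.zip L' ∨ (T.opp p.1, T'.opp p.2) ∈ L.zip L' := by
  induction L generalizing L' with
  | nil => simp [star]
  | cons x L ih =>
    rcases L' with _ | ⟨x', L'⟩
    · simp at h
    have hl : L.length = L'.length := by simpa using h
    have e1 : T.opp p.1 = x ↔ p.1 = T.opp x :=
      ⟨fun e => by rw [← e, T.opp_opp], fun e => by rw [e, T.opp_opp]⟩
    have e2 : T'.opp p.2 = x' ↔ p.2 = T'.opp x' :=
      ⟨fun e => by rw [← e, T'.opp_opp], fun e => by rw [e, T'.opp_opp]⟩
    rw [star, star, List.zip_append (by rw [length_star, length_star, hl])]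
    simp only [List.mem_append, ih hl, List.zip_cons_cons, List.mem_cons, Prod.ext_iff, e1, e2,
      List.zip_nil_right, List.not_mem_nil, or_false]
    tauto

theorem eq_of_mem_zip {A B C : Type} {f : A → C} {g : B → C} {L : List A} {L' : List B}
    (h : L.map f = L'.map g) {p : A × B} (hp : p ∈ L.zip L') : f p.1 = g p.2 := by
  induction L generalizing L' with
  | nil => simp at hp
  | cons x L ih =>
    rcases L' with _ | ⟨x', L'⟩
    · simp at hp
    simp only [List.map_cons, List.cons.injEq] at h
    rcases List.mem_cons.1 hp with rfl | hp
    · exact h.1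
    · exact ih h.2 hp

/-- In a star each side is glued to its neighbour, so the gluing needs no further data, and the
order of the arcs supplies the labels. -/
theorem IsStar.orientedIso {T : Triangulation n D} {T' : Triangulation n E} {t : BinTree α}
    {r : List (Fin n)} (h : T.IsStar t r) (h' : T'.IsStar t r) : OrientedIso T T' := by
  obtain ⟨hT, L, hL, hv, hr⟩ := h
  obtain ⟨hT', L', hL', hv', hr'⟩ := h'
  have hlen : L.length = L'.length := by
    have h1 := congrArg List.length hr
    have h2 := congrArg List.length hr'
    simp only [List.length_map] at h1 h2
    omega
  have hmem : ∀ p, p ∈ T.leafPairs T' T.root T'.root t ↔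
      p ∈ L.zip L' ∨ (T.opp p.1, T'.opp p.2) ∈ L.zip L' := fun p => by
    rw [leafPairs_eq_zip, hL, hL', mem_zip_star T T' hlen]
  refine hT.orientedIso hT' (fun p hp => ?_) fun p hp => ?_
  · rw [hmem] at hp ⊢
    simpa [T.opp_opp, T'.opp_opp] using hp.symm
  · rw [hmem] at hp
    rcases hp with hp | hp
    · rw [hv _ (List.of_mem_zip (a := p.1) (b := p.2) hp).1,
        hv' _ (List.of_mem_zip (a := p.1) (b := p.2) hp).2]
    · have := eq_of_mem_zip (hr.trans hr'.symm) hp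
      simpa [T.opp_opp, T'.opp_opp] using this.symm

/-! ### Rearranging a star -/

/-- The shape of a polygon with sides as in a star, whose diagonals join the first corner to the
points marked by `true`. -/
def beforeShape : List Bool → BinTree Unit
  | [] => .leaf ()
  | [_] => .node (.leaf ()) (.leaf ())
  | b :: b' :: l =>
    if b then .node (.node (beforeShape (b' :: l)) (.leaf ())) (.leaf ())
    else .node (beforeShape (b' :: l)) (.node (.leaf ()) (.leaf ()))

/-- The shape that arises from `beforeShape` by cutting along the diagonals to the points marked by
`true` in place of the sides at these points. -/
def afterShape : List Bool → BinTree Unit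
  | [] => .leaf ()
  | [_] => .node (.leaf ()) (.leaf ())
  | b :: b' :: l =>
    if b then .node (.leaf ()) (.node (.leaf ()) (afterShape (b' :: l)))
    else .node (afterShape (b' :: l)) (.node (.leaf ()) (.leaf ()))

/-- Move the elements with a given property to the end, in reverse order. -/
def pass {A : Type} (p : A → Bool) (r : List A) : List A :=
  (r.filter fun x => !p x) ++ (r.filter p).reverse

theorem count_beforeShape (l : List Bool) (hl : l ≠ []) : (beforeShape l).count = 2 * l.length := by
  induction l with
  | nil => exact absurd rfl hl
  | cons b l ih =>
    rcases l with _ | ⟨b', l⟩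
    · rfl
    · have := ih (by simp)
      rw [beforeShape]
      split_ifs <;> simp only [BinTree.count, this, List.length_cons] <;> ring

theorem pass_cons {A : Type} (p : A → Bool) (a : A) (r : List A) :
    pass p (a :: r) = if p a then pass p r ++ [a] else a :: pass p r := by
  unfold pass
  cases h : p a <;> simp [h]

/-- Let `x` be the head of the list, an arc to `w`. If it is marked `true`, then the diagonal `c =
T.next (T.opp d)` runs from the first corner to `w` and cuts off the triangle with the side `T.opp
x`. Gluing this triangle back along `x` and cutting along `c` replaces the last two sides `x, T.opp
x` by `c, T.opp c` at the beginning, so `w` moves to the other end of the order. If it is marked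
`false`, then `x` stays where it is. -/
theorem exists_star_afterShape (T : Triangulation n D) (p : Option (Fin n) → Bool) (L : List D)
    (d : D) (hd : T.vert d = none) (hv : ∀ x ∈ L, T.vert x = none)
    (hL : T.leafDarts d (beforeShape (L.map fun x => p (T.vert (T.opp x)))) = T.star L) :
    ∃ L' : List D, T.leafDarts d (afterShape (L.map fun x => p (T.vert (T.opp x)))) = T.star L' ∧
      (T.inner d (afterShape (L.map fun x => p (T.vert (T.opp x))))).Perm
        (T.inner d (beforeShape (L.map fun x => p (T.vert (T.opp x))))) ∧
      (∀ x ∈ L', T.vert x = none) ∧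
      L'.map (fun x => T.vert (T.opp x)) = pass p (L.map fun x => T.vert (T.opp x)) := by
  classical
  induction L generalizing d with
  | nil => simp [beforeShape, leafDarts, star] at hL
  | cons x L ih =>
    rcases L with _ | ⟨y, L⟩
    · refine ⟨[x], hL, .refl _, hv, ?_⟩
      · simp only [List.map_cons, List.map_nil, pass_cons]
        split_ifs <;> rfl
    obtain ⟨M, hM⟩ : ∃ M, M = y :: L := ⟨_, rfl⟩
    obtain ⟨l, hl⟩ : ∃ l, l = M.map fun x => p (T.vert (T.opp x)) := ⟨_, rfl⟩
    have hl' : ∃ b' l', l = b' :: l' := by rw [hl, hM]; exact ⟨_, _, rfl⟩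
    have hbe : ∀ b, beforeShape (b :: l) = if b then
        .node (.node (beforeShape l) (.leaf ())) (.leaf ())
        else .node (beforeShape l) (.node (.leaf ()) (.leaf ())) := by
      obtain ⟨b', l', rfl⟩ := hl'
      exact fun _ => rfl
    have haf : ∀ b, afterShape (b :: l) = if b then
        .node (.leaf ()) (.node (.leaf ()) (afterShape l))
        else .node (afterShape l) (.node (.leaf ()) (.leaf ())) := by
      obtain ⟨b', l', rfl⟩ := hl'
      exact fun _ => rfl
    rw [← hM] at ih hL hv ⊢
    rw [← hl] at ih
    replace ih := fun d hd => ih d hd fun x hx => hv x (List.mem_cons_of_mem _ hx)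
    simp only [List.map_cons, ← hl, hbe, haf, pass_cons] at hL ⊢
    have hx0 : T.vert (T.next (T.opp d)) = none := by rw [T.vert_next_opp, hd]
    cases hp : p (T.vert (T.opp x)) with
    | true =>
      simp only [hp, if_true, leafDarts, star, List.append_assoc, List.singleton_append] at hL ⊢
      obtain ⟨h1, h2⟩ := List.append_inj' hL rfl
      simp only [List.cons.injEq, and_true] at h2
      obtain ⟨h2, h3⟩ := h2
      obtain ⟨L', i1, i2, i3, i4⟩ := ih _ (by rw [T.vert_next_opp, hx0]) h1
      have h4 : T.next x = T.opp (T.next (T.opp d)) := by rw [← h2, T.next_next_next]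
      refine ⟨L' ++ [T.next (T.opp d)], ?_, ?_, ?_, ?_⟩
      · rw [h3, T.opp_opp, h4, i1, star_append]
        simp [star]
      · simp only [inner, h2, h3, h4, T.opp_opp, List.append_nil, List.nil_append]
        rw [List.perm_iff_count] at i2 ⊢
        intro a
        have := i2 a
        simp only [List.count_cons, this]
        omega
      · intro z hz
        rcases List.mem_append.1 hz with hz | hz
        · exact i3 z hz
        · rw [List.mem_singleton.1 hz, hx0]
      · rw [List.map_append, i4, List.map_singleton, ← h4, T.vert_next]
    | false =>
      simp only [hp, Bool.false_eq_true, if_false, leafDarts, star, List.singleton_append] at hL ⊢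
      obtain ⟨h1, h2⟩ := List.append_inj' hL rfl
      obtain ⟨L', i1, i2, i3, i4⟩ := ih _ hx0 h1
      refine ⟨x :: L', ?_, ?_, ?_, ?_⟩
      · rw [i1, h2, star]
      · simp only [inner]
        rw [List.perm_iff_count] at i2 ⊢
        intro a
        have := i2 a
        simp only [List.count_cons, List.count_append, this]
      · intro z hz
        rcases List.mem_cons.1 hz with rfl | hz
        · exact hv z (by simp)
        · exact i3 z hz
      · rw [List.map_cons, i4]

/-- A sorting step without flips: the triangulation is the same on both sides, and only the arcs
along which it is cut differ. -/
theorem IsStar.pass {T : Triangulation n D} {r : List (Fin n)} (p : Fin n → Bool)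
    (h : T.IsStar (beforeShape (r.map p)) r) : T.IsStar (afterShape (r.map p)) (pass p r) := by
  obtain ⟨hT, L, hL, hv, hr⟩ := h
  have hp : r.map p = L.map fun x => (T.vert (T.opp x)).elim false p := by
    have := congrArg (List.map fun o : Option (Fin n) => o.elim false p) hr
    simpa [Function.comp_def] using this.symm
  rw [hp] at hT hL ⊢
  obtain ⟨L', h1, h2, h3, h4⟩ := T.exists_star_afterShape (fun o => o.elim false p) L T.root
    T.vert_root hv hL
  refine ⟨hT.of_perm h2, L', h1, h3, ?_⟩
  rw [h4, hr]
  simp [Triangulation.pass, List.filter_map, Function.comp_def]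

/-- Sorting by the binary digits of the labels, the least significant digit first. -/
def radix {n : ℕ} : ℕ → List (Fin n) → List (Fin n)
  | 0, r => r
  | k + 1, r => pass (fun w => w.val.testBit k) (radix k r)

theorem perm_pass {A : Type} (p : A → Bool) (r : List A) : (pass p r).Perm r := by
  refine ((List.reverse_perm _).append_left _).trans (List.perm_append_comm.trans ?_)
  exact List.filter_append_perm p r

theorem perm_radix (k : ℕ) (r : List (Fin n)) : (radix k r).Perm r := by
  induction k with
  | zero => exact .refl _
  | succ k ih => exact (perm_pass _ _).trans ih

/-- The invariant of radix sort: after `k` passes the order among labels with the same higher digits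
no longer depends on the input. A pass concatenates the class of `2 * c` with the reversed class of
`2 * c + 1`; the reversal does no harm because it happens for both inputs. For `k = 0` a class
consists of copies of one label, so its length determines it. -/
theorem filter_radix (k : ℕ) {r r' : List (Fin n)} (h : r.Perm r') (c : ℕ) :
    (radix k r).filter (fun w => w.val / 2 ^ k = c) =
      (radix k r').filter fun w => w.val / 2 ^ k = c := by
  induction k generalizing c with
  | zero =>
    simp only [radix, pow_zero, Nat.div_one]
    have h1 := h.filter fun w : Fin n => decide (w.val = c)
    have h2 : ∀ l : List (Fin n), ∀ a ∈ l.filter (fun w : Fin n => decide (w.val = c)),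
        a.val = c := fun l a ha => by simpa using (List.mem_filter.1 ha).2
    rcases hr : r.filter (fun w : Fin n => decide (w.val = c)) with _ | ⟨a, l⟩
    · rw [hr] at h1
      exact h1.nil_eq
    · have ha : a.val = c := h2 r a (by rw [hr]; simp)
      have e : ∀ l' : List (Fin n), (∀ b ∈ l', b.val = c) → l' = List.replicate l'.length a :=
        fun l' hl' => List.eq_replicate_iff.2 ⟨rfl, fun b hb => Fin.ext ((hl' b hb).trans ha.symm)⟩
      rw [← hr, e _ (h2 r), e _ (h2 r'), h1.length_eq]
  | succ k ih =>
    have key : ∀ l : List (Fin n), (pass (fun w : Fin n => w.val.testBit k) l).filter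
        (fun w => w.val / 2 ^ (k + 1) = c) = l.filter (fun w => w.val / 2 ^ k = 2 * c) ++
          (l.filter fun w => w.val / 2 ^ k = 2 * c + 1).reverse := by
      intro l
      rw [pass, List.filter_append, List.filter_reverse, List.filter_filter, List.filter_filter]
      have e : ∀ w : Fin n, w.val / 2 ^ (k + 1) = w.val / 2 ^ k / 2 := fun w => by
        rw [pow_succ, Nat.div_div_eq_div_mul]
      refine congrArg₂ _ (List.filter_congr fun w _ => ?_)
        (congrArg _ (List.filter_congr fun w _ => ?_)) <;>
      · rw [e, Nat.testBit_eq_decide_div_mod_eq, Bool.eq_iff_iff]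
        simp
        omega
    rw [radix, radix, key, key, ih, ih]

theorem radix_eq (k : ℕ) (hk : n ≤ 2 ^ k) {r r' : List (Fin n)} (h : r.Perm r') :
    radix k r = radix k r' := by
  have := filter_radix k h 0
  have e : ∀ w : Fin n, w.val / 2 ^ k = 0 := fun w => Nat.div_eq_of_lt (w.2.trans_le hk)
  simpa [e] using this

/-! ### Distances in the flip graph -/

theorem edist_le_one (s : Setoid (Tri n)) {m : ℕ} {S : Set (Fin m)}
    {T T' : Triangulation n (Fin m)} (h : FlipAlong S T T') :
    (flipGraph s).edist (Quotient.mk s ⟨m, T⟩) (Quotient.mk s ⟨m, T'⟩) ≤ 1 := by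
  by_cases he : (Quotient.mk s ⟨m, T⟩) = Quotient.mk s ⟨m, T'⟩
  · rw [he, SimpleGraph.edist_self]
    exact zero_le
  · refine le_of_eq (SimpleGraph.edist_eq_one_iff_adj.2 ?_)
    exact ⟨he, Or.inl ⟨m, S, T, T', h, rfl, rfl⟩⟩

theorem Develops.exists_simRots (s : Setoid (Tri n)) {m : ℕ} {k : ℕ} {T : Triangulation n (Fin m)}
    {t t' : BinTree α} (hT : T.Develops t) (h : t.SimRots k t') :
    ∃ T' : Triangulation n (Fin m), T'.Develops t' ∧ T'.opp = T.opp ∧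
      T'.leafDarts T'.root t' = T.leafDarts T.root t ∧
      (∀ x ∈ T.leafDarts T.root t, T'.vert x = T.vert x) ∧
      (flipGraph s).edist (Quotient.mk s ⟨m, T⟩) (Quotient.mk s ⟨m, T'⟩) ≤ k := by
  induction k generalizing T t with
  | zero =>
    obtain rfl : t = t' := h
    exact ⟨T, hT, rfl, rfl, fun _ _ => rfl, by simp⟩
  | succ k ih =>
    obtain ⟨u, h1, h2⟩ := h
    obtain ⟨S, T₁, hS, hT₁, a1, a2, a3⟩ := hT.exists_flipAlong h1
    obtain ⟨T₂, hT₂, b1, b2, b3, b4⟩ := ih hT₁ h2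
    refine ⟨T₂, hT₂, b1.trans a1, b2.trans a2, fun x hx => ?_, ?_⟩
    · rw [b3 x (by rwa [a2]), a3 x hx]
    · refine (SimpleGraph.edist_triangle (v := Quotient.mk s ⟨m, T₁⟩)).trans ?_
      rw [Nat.cast_succ, add_comm]
      exact add_le_add b4 (edist_le_one s hS)

theorem star_congr {T T' : Triangulation n D} (h : T'.opp = T.opp) (L : List D) :
    T'.star L = T.star L := by
  induction L with
  | nil => rfl
  | cons x L ih => rw [star, star, ih, h]

theorem IsStar.exists_simRots (s : Setoid (Tri n)) {m : ℕ} {k : ℕ} {T : Triangulation n (Fin m)}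
    {t t' : BinTree α} {r : List (Fin n)} (hT : T.IsStar t r) (h : t.SimRots k t') :
    ∃ T' : Triangulation n (Fin m), T'.IsStar t' r ∧
      (flipGraph s).edist (Quotient.mk s ⟨m, T⟩) (Quotient.mk s ⟨m, T'⟩) ≤ k := by
  obtain ⟨hD, L, hL, hv, hr⟩ := hT
  obtain ⟨T', h1, h2, h3, h4, h5⟩ := hD.exists_simRots s h
  rw [hL] at h4
  refine ⟨T', ⟨h1, L, by rw [h3, hL, star_congr h2], fun x hx => ?_, ?_⟩, h5⟩
  · rw [h4 x (T.mem_star_of_mem hx).1, hv x hx]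
  · rw [← hr, h2]
    exact List.map_congr_left fun x hx => h4 _ (T.mem_star_of_mem hx).2

theorem leaves_eq_of_count_eq {t t' : BinTree Unit} (h : t.count = t'.count) :
    t.leaves = t'.leaves := by
  rw [List.eq_replicate_iff.2 ⟨t.length_leaves, fun b _ => Subsingleton.elim b ()⟩,
    List.eq_replicate_iff.2 ⟨t'.length_leaves, fun b _ => Subsingleton.elim b ()⟩, h]

/-- Every triangulation is close to one that is cut into a polygon by a star. -/
theorem exists_isStar_edist_le (s : Setoid (Tri n)) {m j : ℕ} (hj : 2 * n * 5 ^ j ≤ 6 ^ j)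
    (T : Triangulation n (Fin m)) :
    ∃ (T' : Triangulation n (Fin m)) (t : BinTree Unit) (r : List (Fin n)), T'.IsStar t r ∧
      r.Perm (List.finRange n) ∧
      (flipGraph s).edist (Quotient.mk s ⟨m, T⟩) (Quotient.mk s ⟨m, T'⟩) ≤ (3 * j : ℕ) := by
  obtain ⟨t, ht⟩ := T.exists_develops_of_finite
  obtain ⟨u, hu, h1⟩ := t.simRots_comb j (by rwa [ht.count_eq])
  obtain ⟨T', h2, -, -, -, h3⟩ := ht.exists_simRots s h1
  have h4 : ∃ a L, u = BinTree.spine (.leaf a) L := by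
    rcases hl : t.leaves with _ | ⟨a, L⟩
    · rw [hl] at hu; cases hu
    · rw [hl] at hu
      exact ⟨a, L, (Option.some.inj hu).symm⟩
  obtain ⟨a, L, rfl⟩ := h4
  -- The comb is a fan at the boundary marked point, so every marked point is adjacent to it and a
  -- star can be chosen.
  obtain ⟨t', r, h5, h6⟩ := T'.exists_isStar fun p => by
    rcases List.mem_cons.1 (h2.mem p) with rfl | hp
    · exact Or.inl T'.vert_root
    · exact T'.vert_adjacent_of_spine _ T'.vert_root a L p hp
  exact ⟨T', t', r, h5, h6, h3⟩

/-- Reaching a star takes `3 * j` flips. Each sorting pass takes `6 * j` flips to bring the polygon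
into the form `beforeShape`; the new cut is free. -/
theorem exists_isStar_radix (s : Setoid (Tri n)) (hn : 1 ≤ n) {m j : ℕ}
    (hj : 2 * n * 5 ^ j ≤ 6 ^ j) (T : Triangulation n (Fin m)) (k : ℕ) :
    ∃ (T' : Triangulation n (Fin m)) (t : BinTree Unit) (r : List (Fin n)),
      T'.IsStar t (radix k r) ∧ r.Perm (List.finRange n) ∧
      (flipGraph s).edist (Quotient.mk s ⟨m, T⟩) (Quotient.mk s ⟨m, T'⟩) ≤
        (3 * j + 6 * j * k : ℕ) := by
  induction k with
  | zero =>
    obtain ⟨T', t, r, h⟩ := exists_isStar_edist_le s hj T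
    exact ⟨T', t, r, by simpa [radix] using h⟩
  | succ k ih =>
    obtain ⟨T', t, r, h1, h2, h3⟩ := ih
    have hlen : (radix k r).length = n := by
      rw [(perm_radix k r).length_eq, h2.length_eq, List.length_finRange]
    obtain ⟨p, hp⟩ : ∃ p : Fin n → Bool, p = fun w => w.val.testBit k := ⟨_, rfl⟩
    have hc : t.count = (beforeShape ((radix k r).map p)).count := by
      rw [h1.1.count_eq, count_beforeShape _ (by
        intro e
        rw [List.map_eq_nil_iff] at e
        rw [e] at hlen
        simp at hlen
        omega), List.length_map, hlen]
    obtain ⟨T'', h4, h5⟩ := h1.exists_simRots s (BinTree.exists_simRots j t _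
      (leaves_eq_of_count_eq hc) (by rwa [h1.1.count_eq]))
    refine ⟨T'', afterShape ((radix k r).map p), r, ?_, h2, ?_⟩
    · rw [radix, ← hp]
      exact h4.pass
    · refine (SimpleGraph.edist_triangle (v := Quotient.mk s ⟨m, T'⟩)).trans ?_
      refine (add_le_add h3 h5).trans (le_of_eq ?_)
      rw [← Nat.cast_add]
      congr 1
      ring

/-- Both triangulations are taken to sorted stars, at a cost of `3 * j + 6 * j * k` each. The stars
then have the same order, and `6 * j` flips make their shapes agree, so that they are homeomorphic.
-/
theorem edist_le (s : Setoid (Tri n)) (hs : ∀ X Y : Tri n, OrientedIso X.2 Y.2 → s X Y)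
    (hn : 1 ≤ n) {j k : ℕ} (hj : 2 * n * 5 ^ j ≤ 6 ^ j) (hk : n ≤ 2 ^ k)
    (X Y : Quotient s) : (flipGraph s).edist X Y ≤ (12 * j * (k + 1) : ℕ) := by
  obtain ⟨⟨m, T⟩, rfl⟩ := Quotient.exists_rep X
  obtain ⟨⟨m', T'⟩, rfl⟩ := Quotient.exists_rep Y
  obtain ⟨T₁, t, r, h1, h2, h3⟩ := exists_isStar_radix s hn hj T k
  obtain ⟨T₁', t', r', h1', h2', h3'⟩ := exists_isStar_radix s hn hj T' k
  obtain ⟨T₂, h4, h5⟩ := h1.exists_simRots s (BinTree.exists_simRots j t t'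
    (leaves_eq_of_count_eq (h1.1.count_eq.trans h1'.1.count_eq.symm)) (by rwa [h1.1.count_eq]))
  rw [radix_eq k hk (h2.trans h2'.symm)] at h4
  have h6 : (Quotient.mk s ⟨m, T₂⟩) = Quotient.mk s ⟨m', T₁'⟩ :=
    Quotient.sound (hs _ _ (h4.orientedIso h1'))
  rw [h6] at h5
  rw [SimpleGraph.edist_comm] at h3'
  refine (SimpleGraph.edist_triangle (v := Quotient.mk s ⟨m', T₁'⟩)).trans ?_
  refine (add_le_add (SimpleGraph.edist_triangle (v := Quotient.mk s ⟨m, T₁⟩)) h3').trans ?_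
  refine (add_le_add (add_le_add h3 h5) le_rfl).trans (le_of_eq ?_)
  rw [← Nat.cast_add, ← Nat.cast_add]
  congr 1
  ring

end Triangulation

/-! ### Existence of triangulations -/

/-- The elementary properties of a triangulation, with permutations given as functions and orbits
described by sets that are closed under them. -/
structure Gluing (n : ℕ) (D : Type) where
  next : D → D
  opp : D → D
  root : D
  vert : D → Option (Fin n)
  opp_opp : ∀ d, opp (opp d) = d
  opp_ne : ∀ d, opp d ≠ d
  next_root : next root = root
  next_ne : ∀ d, d ≠ root → next d ≠ d
  next_next_next : ∀ d, next (next (next d)) = d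
  connected : ∀ C : Set D, root ∈ C → (∀ d ∈ C, next d ∈ C) → (∀ d ∈ C, opp d ∈ C) → ∀ d, d ∈ C
  vert_next_opp : ∀ d, vert (next (opp d)) = vert d
  mem_of_vert_eq : ∀ C : Set D, (∀ d ∈ C, next (opp d) ∈ C) → ∀ d d', vert d = vert d' →
    d ∈ C → d' ∈ C
  vert_surjective : Function.Surjective vert
  vert_root : vert root = none

namespace Gluing

variable {n : ℕ} {D E : Type}

/-- Transport of a gluing to another set of darts. -/
def transport (T : Gluing n D) (e : D ≃ E) : Gluing n E where
  next d := e (T.next (e.symm d))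
  opp d := e (T.opp (e.symm d))
  root := e T.root
  vert d := T.vert (e.symm d)
  opp_opp d := by simp [T.opp_opp]
  opp_ne d h := T.opp_ne (e.symm d) (by rw [Equiv.eq_symm_apply]; exact h)
  next_root := by simp [T.next_root]
  next_ne d hd h := T.next_ne (e.symm d) (fun e' => hd (by rw [← e', Equiv.apply_symm_apply]))
    (by rw [Equiv.eq_symm_apply]; exact h)
  next_next_next d := by simp [T.next_next_next]
  connected C h1 h2 h3 d := by
    have := T.connected (e ⁻¹' C) h1 (fun d hd => by simpa using h2 _ hd)
      (fun d hd => by simpa using h3 _ hd) (e.symm d)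
    simpa using this
  vert_next_opp d := by simp [T.vert_next_opp]
  mem_of_vert_eq C h d d' hv hd := by
    have := T.mem_of_vert_eq (e ⁻¹' C) (fun d hd => by simpa using h _ hd) _ _ hv (by simpa using hd)
    simpa using this
  vert_surjective w := by
    obtain ⟨d, rfl⟩ := T.vert_surjective w
    exact ⟨e d, by simp⟩
  vert_root := by simp [T.vert_root]

/-- A gluing with the right number of darts is a triangulation. -/
theorem nonempty_triangulation [Finite D] (T : Gluing n D) (hD : Nat.card D + 2 = 6 * n) :
    Nonempty (Triangulation n D) := by
  let f : Perm D := ⟨T.next, fun d => T.next (T.next d), T.next_next_next, T.next_next_next⟩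
  let o : Perm D := ⟨T.opp, T.opp, T.opp_opp, T.opp_opp⟩
  have hv : ∀ d d', T.vert d = T.vert d' ↔ (f * o).SameCycle d d' := fun d d' =>
    ⟨fun h => T.mem_of_vert_eq {x | (f * o).SameCycle d x}
      (fun x hx => Perm.SameCycle.trans hx ⟨1, by simp [f, o]⟩) d d' h (.refl _ _),
      Triangulation.eq_of_forall_step fun d => T.vert_next_opp d⟩
  have hc : ∀ d, ∃ g ∈ Subgroup.closure ({f, o} : Set (Perm D)), g T.root = d := by
    refine T.connected {d | ∃ g ∈ Subgroup.closure ({f, o} : Set (Perm D)), g T.root = d}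
      ⟨1, one_mem _, rfl⟩ ?_ ?_
    · rintro d ⟨g, hg, rfl⟩
      exact ⟨f * g, mul_mem (Subgroup.subset_closure (by simp)) hg, rfl⟩
    · rintro d ⟨g, hg, rfl⟩
      exact ⟨o * g, mul_mem (Subgroup.subset_closure (by simp)) hg, rfl⟩
  refine ⟨⟨f, o, T.root, T.vert, T.opp_opp, T.opp_ne, T.next_root, T.next_ne, T.next_next_next,
    fun d d' => ?_, hv, T.vert_surjective, T.vert_root, ?_⟩⟩
  · obtain ⟨g, hg, rfl⟩ := hc d
    obtain ⟨g', hg', rfl⟩ := hc d'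
    exact ⟨g' * g⁻¹, mul_mem hg' (inv_mem hg), by simp⟩
  · have h1 := two_mul_orbitCount (f := o) T.opp_opp T.opp_ne
    have h2 := three_mul_orbitCount (f := f) T.next_next_next T.next_root T.next_ne
    have h3 := orbitCount_eq_of_labels _ _ hv T.vert_surjective
    simp only [Nat.card_eq_fintype_card (α := Option (Fin n)), Fintype.card_option,
      Fintype.card_fin] at h3
    omega

/-- The disk with one interior marked point, cut into a self-folded triangle. -/
def one : Gluing 1 (Fin 4) where
  next := ![0, 2, 3, 1]
  opp := ![1, 0, 3, 2]
  root := 0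
  vert := ![none, none, none, some 0]
  opp_opp := by decide
  opp_ne := by decide
  next_root := by decide
  next_ne := by decide
  next_next_next := by decide
  connected C h0 h1 h2 := by
    have c1 : (1 : Fin 4) ∈ C := h2 0 h0
    have c2 : (2 : Fin 4) ∈ C := h1 1 c1
    have c3 : (3 : Fin 4) ∈ C := h1 2 c2
    intro d
    fin_cases d <;> assumption
  vert_next_opp := by decide
  mem_of_vert_eq C h d d' hv hd := by
    have c0 : (0 : Fin 4) ∈ C → (2 : Fin 4) ∈ C := fun c => h 0 c
    have c1 : (1 : Fin 4) ∈ C → (0 : Fin 4) ∈ C := fun c => h 1 c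
    have c2 : (2 : Fin 4) ∈ C → (1 : Fin 4) ∈ C := fun c => h 2 c
    fin_cases d <;> fin_cases d' <;> simp at hv hd ⊢ <;> tauto
  vert_surjective := by decide
  vert_root := by decide

open Classical in
/-- Enclose the boundary curve and a loop around a new marked point by a new boundary curve. -/
noncomputable def insert (T : Gluing n D) : Gluing (n + 1) (D ⊕ Fin 6) where
  -- The darts 0 and 1 form the new boundary curve, 2 and 3 the loop, 4 and 5 the arc inside the
  -- loop. The new triangles are (1, old root, 2) and the self-folded (3, 4, 5).
  next := Sum.elim (fun d => if d = T.root then .inr 2 else .inl (T.next d))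
    ![.inr 0, .inl T.root, .inr 1, .inr 4, .inr 5, .inr 3]
  opp := Sum.elim (fun d => .inl (T.opp d)) ![.inr 1, .inr 0, .inr 3, .inr 2, .inr 5, .inr 4]
  root := .inr 0
  vert := Sum.elim (fun d => (T.vert d).map Fin.castSucc)
    ![none, none, none, none, none, some (Fin.last n)]
  opp_opp d := by
    rcases d with d | d
    · simp [T.opp_opp]
    · fin_cases d <;> rfl
  opp_ne d := by
    rcases d with d | d
    · simp [T.opp_ne]
    · fin_cases d <;> simp
  next_root := rfl
  next_ne d hd := by
    rcases d with d | d
    · by_cases h : d = T.root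
      · simp [h]
      · simpa [h] using T.next_ne d h
    · fin_cases d <;> simp at hd ⊢
  next_next_next d := by
    have hn : ∀ d, d ≠ T.root → T.next d ≠ T.root := fun d hd e => hd (by
      have := T.next_next_next d
      rw [e, T.next_root, T.next_root] at this
      exact this.symm)
    rcases d with d | d
    · by_cases h : d = T.root
      · simp [h]
      · simp [h, hn, T.next_next_next]
    · fin_cases d <;> simp
  connected C h0 h1 h2 := by
    have c1 : (.inr 1 : D ⊕ Fin 6) ∈ C := h2 _ h0
    have cr : (.inl T.root : D ⊕ Fin 6) ∈ C := h1 _ c1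
    have c2 : (.inr 2 : D ⊕ Fin 6) ∈ C := by simpa using h1 _ cr
    have c3 : (.inr 3 : D ⊕ Fin 6) ∈ C := h2 _ c2
    have c4 : (.inr 4 : D ⊕ Fin 6) ∈ C := h1 _ c3
    have c5 : (.inr 5 : D ⊕ Fin 6) ∈ C := h1 _ c4
    have hT := T.connected (Sum.inl ⁻¹' C) cr (fun d hd => by
      by_cases h : d = T.root
      · rw [h, T.next_root]; exact cr
      · simpa [h] using h1 _ hd) (fun d hd => h2 _ hd)
    rintro (d | d)
    · exact hT d
    · fin_cases d <;> assumption
  vert_next_opp d := by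
    rcases d with d | d
    · by_cases h : T.opp d = T.root
      · have := T.vert_next_opp d
        rw [h, T.next_root, T.vert_root] at this
        simp [h, ← this]
      · simp [h, T.vert_next_opp]
    · fin_cases d <;> simp [T.vert_root]
  mem_of_vert_eq C h := by
    -- About the boundary marked point, the new darts 2, 4, 3, 1, 0 are inserted in this order just
    -- before the old root; elsewhere the old rotation is unchanged.
    have c0 : (.inr 0 : D ⊕ Fin 6) ∈ C → (.inl T.root : D ⊕ Fin 6) ∈ C := fun c => h _ c
    have c1 : (.inr 1 : D ⊕ Fin 6) ∈ C → (.inr 0 : D ⊕ Fin 6) ∈ C := fun c => h _ c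
    have c3 : (.inr 3 : D ⊕ Fin 6) ∈ C → (.inr 1 : D ⊕ Fin 6) ∈ C := fun c => h _ c
    have c4 : (.inr 4 : D ⊕ Fin 6) ∈ C → (.inr 3 : D ⊕ Fin 6) ∈ C := fun c => h _ c
    have c2 : (.inr 2 : D ⊕ Fin 6) ∈ C → (.inr 4 : D ⊕ Fin 6) ∈ C := fun c => h _ c
    have cl : ∀ d, T.opp d = T.root → (.inl d : D ⊕ Fin 6) ∈ C → (.inr 2 : D ⊕ Fin 6) ∈ C :=
      fun d hd c => by simpa [hd] using h _ c
    have hT := T.mem_of_vert_eq (Sum.inl ⁻¹' C) (fun d hd => by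
      by_cases e : T.opp d = T.root
      · rw [e, T.next_root]
        exact c0 (c1 (c3 (c4 (c2 (cl d e hd)))))
      · simpa [e] using h _ hd)
    have hr : T.vert (T.opp T.root) = none := by
      have := T.vert_next_opp (T.opp T.root)
      rw [T.opp_opp, T.next_root, T.vert_root] at this
      exact this.symm
    have hall : ∀ d, T.vert d = none → (.inl d : D ⊕ Fin 6) ∈ C → ∀ d' : Fin 6, d' ≠ 5 →
        (.inr d' : D ⊕ Fin 6) ∈ C := by
      intro d hd hC
      have a2 := cl _ (T.opp_opp _) (hT d (T.opp T.root) (hd.trans hr.symm) hC)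
      have a4 := c2 a2
      have a3 := c4 a4
      have a1 := c3 a3
      have a0 := c1 a1
      intro d' hd'
      fin_cases d' <;> first | assumption | exact absurd rfl hd'
    have hin : ∀ d' : Fin 6, d' ≠ 5 → (.inr d' : D ⊕ Fin 6) ∈ C →
        (.inl T.root : D ⊕ Fin 6) ∈ C := by
      intro d' hd'
      fin_cases d' <;> simp at hd' ⊢ <;> tauto
    have hn : ∀ d' : Fin 6, d' ≠ 5 → (![none, none, none, none, none, some (Fin.last n)] :
        Fin 6 → Option (Fin (n + 1))) d' = none := by
      intro d' hd'
      fin_cases d' <;> simp at hd' ⊢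
    have hne : ∀ d, (T.vert d).map Fin.castSucc ≠ some (Fin.last n) := by
      intro d e
      obtain ⟨w, -, hw⟩ := Option.map_eq_some_iff.1 e
      exact Fin.castSucc_ne_last w hw
    rintro (d | d) (d' | d') hv hd
    · exact hT d d' (Option.map_injective (Fin.castSucc_injective n) hv) hd
    · by_cases e : d' = 5
      · rw [e] at hv
        exact absurd hv (hne d)
      · simp only [Sum.elim_inl, Sum.elim_inr, hn d' e, Option.map_eq_none_iff] at hv
        exact hall d hv hd d' e
    · by_cases e : d = 5
      · rw [e] at hv
        exact absurd hv.symm (hne d')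
      · simp only [Sum.elim_inl, Sum.elim_inr, hn d e] at hv
        exact hT T.root d' (T.vert_root.trans (Option.map_eq_none_iff.1 hv.symm).symm) (hin d e hd)
    · by_cases e : d = 5
      · by_cases e' : d' = 5
        · rwa [e', ← e]
        · simp only [Sum.elim_inr, hn d' e', e] at hv
          cases hv
      · by_cases e' : d' = 5
        · simp only [Sum.elim_inr, hn d e, e'] at hv
          cases hv
        · exact hall T.root T.vert_root (hin d e hd) d' e'
  vert_surjective w := by
    rcases w with _ | w
    · exact ⟨.inr 0, rfl⟩
    · induction w using Fin.lastCases with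
      | last => exact ⟨.inr 5, rfl⟩
      | cast w =>
        obtain ⟨d, hd⟩ := T.vert_surjective (some w)
        exact ⟨.inl d, by simp [hd]⟩
  vert_root := rfl

end Gluing

/-- Connectedness includes that the graph has a vertex, which the distance bound does not give. -/
theorem nonempty_tri (n : ℕ) (hn : 1 ≤ n) : Nonempty (Tri n) := by
  have key : ∃ (D : Type) (_ : Finite D) (_ : Gluing n D), Nat.card D + 2 = 6 * n := by
    induction n, hn using Nat.le_induction with
    | base => exact ⟨Fin 4, inferInstance, Gluing.one, by simp⟩
    | succ n _ ih =>
      obtain ⟨D, hD, T, hc⟩ := ih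
      refine ⟨D ⊕ Fin 6, inferInstance, T.insert, ?_⟩
      rw [Nat.card_sum, Nat.card_eq_fintype_card (α := Fin 6), Fintype.card_fin]
      omega
  obtain ⟨D, hD, T, hc⟩ := key
  obtain ⟨T'⟩ := (T.transport (Finite.equivFin D)).nonempty_triangulation (by simpa using hc)
  exact ⟨⟨_, T'⟩⟩

/-! ### The numerical bound -/

theorem flipGraph_diam (n : ℕ) (hn : 1 ≤ n) (s : Setoid (Tri n))
    (hs : ∀ X Y : Tri n, OrientedIso X.2 Y.2 → s X Y) :
    (flipGraph s).Connected ∧ (flipGraph s).ediam ≠ ⊤ ∧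
      ((flipGraph s).diam : ℝ) < 1000 * (Real.log ((n : ℝ) + 1)) ^ 2 := by
  obtain ⟨k, hk⟩ : ∃ k, k = Nat.clog 2 n := ⟨_, rfl⟩
  have h1 : n ≤ 2 ^ k := by rw [hk]; exact Nat.le_pow_clog (by norm_num) n
  -- For `n > 1` the choice of `k` gives `2 ^ (k - 1) < n`, and `4 * n ≤ (n + 1) ^ 2`.
  have h2 : 2 ^ (k + 1) ≤ (n + 1) ^ 2 := by
    rcases Nat.lt_or_ge 1 n with h | h
    · have h3 := Nat.pow_pred_clog_lt_self (b := 2) (by norm_num) h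
      have h4 : 0 < k := by rw [hk]; exact Nat.clog_pos (by norm_num) h
      rw [← hk] at h3
      obtain ⟨i, rfl⟩ : ∃ i, k = i + 1 := ⟨k - 1, by omega⟩
      simp only [Nat.pred_eq_sub_one, Nat.add_sub_cancel] at h3
      rw [pow_succ, pow_succ]
      nlinarith
    · obtain rfl : n = 1 := by omega
      simp [hk]
  -- The choice `j = 4 * (k + 1)` works because `2 * 5 ^ 4 = 1250 ≤ 1296 = 6 ^ 4`: four rounds of
  -- contraction at least halve the number of leaves.
  have h3 : 2 * n * 5 ^ (4 * (k + 1)) ≤ 6 ^ (4 * (k + 1)) := by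
    rw [pow_mul, pow_mul]
    calc 2 * n * (5 ^ 4) ^ (k + 1) ≤ 2 ^ (k + 1) * (5 ^ 4) ^ (k + 1) :=
          Nat.mul_le_mul_right _ (by rw [pow_succ]; omega)
      _ = (2 * 5 ^ 4) ^ (k + 1) := (mul_pow _ _ _).symm
      _ ≤ (6 ^ 4) ^ (k + 1) := Nat.pow_le_pow_left (by norm_num) _
  have h4 := fun X Y => Triangulation.edist_le s hs hn h3 h1 X Y
  have h5 : (flipGraph s).ediam ≤ (12 * (4 * (k + 1)) * (k + 1) : ℕ) :=
    SimpleGraph.ediam_le_of_edist_le h4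
  have h6 : (flipGraph s).ediam ≠ ⊤ := ne_top_of_le_ne_top (ENat.natCast_ne_top _) h5
  refine ⟨?_, h6, ?_⟩
  · have : Nonempty (Quotient s) := (nonempty_tri n hn).map (Quotient.mk s)
    exact ⟨fun X Y => SimpleGraph.edist_ne_top_iff_reachable.1
      (ne_top_of_le_ne_top (ENat.natCast_ne_top _) (h4 X Y))⟩
  · have h7 : (flipGraph s).diam ≤ 12 * (4 * (k + 1)) * (k + 1) := by
      have := ENat.toNat_le_toNat h5 (ENat.natCast_ne_top _)
      rwa [ENat.toNat_natCast] at this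
    have h8 : ((flipGraph s).diam : ℝ) ≤ 48 * ((k : ℝ) + 1) ^ 2 := by
      have : ((flipGraph s).diam : ℝ) ≤ (12 * (4 * (k + 1)) * (k + 1) : ℕ) := by exact_mod_cast h7
      refine this.trans (le_of_eq ?_)
      push_cast
      ring
    have h9 : ((k : ℝ) + 1) * Real.log 2 ≤ 2 * Real.log ((n : ℝ) + 1) := by
      have h10 : ((2 : ℝ) ^ (k + 1)) ≤ ((n : ℝ) + 1) ^ 2 := by exact_mod_cast h2
      have := Real.log_le_log (by positivity) h10
      rw [Real.log_pow, Real.log_pow] at this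
      push_cast at this
      exact this
    have h10 := Real.log_two_gt_d9
    have hk0 : (0 : ℝ) ≤ k := Nat.cast_nonneg k
    -- Since `log 2 / 2 > 1 / 3`, the bound `48 * (k + 1) ^ 2` is at most `48 * 9 = 432` times the
    -- squared logarithm.
    have h11 : ((k : ℝ) + 1) * (1 / 3) ≤ Real.log ((n : ℝ) + 1) := by nlinarith
    have h12 : (((k : ℝ) + 1) * (1 / 3)) ^ 2 ≤ Real.log ((n : ℝ) + 1) ^ 2 :=
      pow_le_pow_left₀ (by positivity) h11 2
    nlinarith

end FlipDisk

theorem theorem3p1 (n : ℕ) (hn : 1 ≤ n) :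
    ((FlipDisk.modularFlipGraph n).Connected ∧ (FlipDisk.modularFlipGraph n).ediam ≠ ⊤ ∧
      ((FlipDisk.modularFlipGraph n).diam : ℝ) < 1000 * (Real.log ((n : ℝ) + 1)) ^ 2) ∧
    ((FlipDisk.orientedModularFlipGraph n).Connected ∧
      (FlipDisk.orientedModularFlipGraph n).ediam ≠ ⊤ ∧
      ((FlipDisk.orientedModularFlipGraph n).diam : ℝ) <
        1000 * (Real.log ((n : ℝ) + 1)) ^ 2) :=
  ⟨FlipDisk.flipGraph_diam n hn (FlipDisk.homeoSetoid n) fun _ _ h => Or.inl h,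
    FlipDisk.flipGraph_diam n hn (FlipDisk.orientedSetoid n) fun _ _ h => h⟩
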